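/- Let $m,n,r\ge 1$ be integers. We observe $X=M+Z\in\mathbb R^{m\times n}$ with $$M=\sum_{s=1}^r\lambda_s\,1_{R_s}1_{C_s}^T,$$ where the row supports $R_1,\dots,R_r\subseteq[m]$ are pairwise disjoint and the column supports $C_1,\dots,C_r\subseteq[n]$ are pairwise disjoint. The entries of $Z$ are i.i.d., centred and sub-Gaussian with parameter $\sigma>0$, that is, $\mathbb E e^{tZ_{ij}}\le\exp(\sigma^2t^2/(2a))$ for all $t\in\mathbb R$, where $a>0$ is a fixed constant. **Algorithm.** Take a singular value decomposition $X=U\Sigma V^T$ with nonincreasing singular values, and let $U_r\in\mathbb R^{m\times r}$, $V_r\in\mathbb R^{n\times r}$ consist of its top $r$ left and right singular vectors. Apply $k$-means with $k=r+1$ (a global minimiser of $\sum_j\|x_j-c_{l(j)}\|_2^2$ over the labels $l$ and the centres $c_1,\dots,c_{r+1}$) to the $n$ vectors $U_r(U_r^TU_r)^{-1}U_r^TX_{\cdot j}$, $1\le j\le n$. Separately, apply $k$-means with $k=r+1$ to the $m$ vectors $V_r(V_r^TV_r)^{-1}V_r^TX_{i\cdot}^T$, $1\le i\le m$. **Assumptions.**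 Fix $K\ge1$. Let $k_m,k_n,\lambda>0$ be such that for all $s$ $$K^{-1}k_m\le|R_s|\le Kk_m,\qquad K^{-1}k_n\le|C_s|\le Kk_n,\qquad K^{-1}\lambda\le\lambda_s\le K\lambda.$$ Assume that the background is not of smaller order than the supports, $$m-\sum_s|R_s|\ge K^{-1}k_m,\qquad n-\sum_s|C_s|\ge K^{-1}k_n,$$ and that $\min\{k_m,k_n\}\ge K^{-1}\max\{\sqrt m,\sqrt n\}$. **Claim.** There are constants $C,c>0$ depending only on $K$ and $a$ (in particular not on $m,n,r,k_m,k_n,\lambda,\sigma$, so that $r$ may grow) such that, whenever $$\frac{\lambda}{\sigma}\ge C\left(\sqrt{\frac r{k_m\wedge k_n}}+\sqrt{\frac{\log n}{k_m}}\vee\sqrt{\frac{\log m}{k_n}}+\sqrt{\frac{m\vee n}{k_mk_n}}\right),$$ the following holds with probability at least $1-m^{-c}-n^{-c}-2\exp(-c(m+n))$. For every choice of the singular vectors and of the $k$-means minimisers, the $r+1$ clusters of columns are, up to the names of the labels, exactly $C_1,\dots,C_r$ and the background $[n]\setminus\bigcup_sC_s$, and the $r+1$ clusters of rows are exactly $R_1,\dots,R_r$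 and the background $[m]\setminus\bigcup_sR_s$. In both cases the background is the cluster whose centre has strictly the smallest norm, so that the $r$ estimated supports can be read off. -/

import Mathlib

open MeasureTheory ProbabilityTheory

noncomputable section

namespace SubmatrixLocalization

/-- The indicator vector `1_S` of an index set `S`. -/
def indicatorVec {p : ℕ} (S : Finset (Fin p)) : Fin p → ℝ :=
  fun i => if i ∈ S then 1 else 0

/-- The mean matrix `M = ∑ s, lam s • 1_{R s} 1_{C s}ᵀ` of the multiple submatrices model. -/
def signal {m n r : ℕ} (lam : Fin r → ℝ) (R : Fin r → Finset (Fin m))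
    (C : Fin r → Finset (Fin n)) : Matrix (Fin m) (Fin n) ℝ :=
  ∑ s, lam s • Matrix.vecMulVec (indicatorVec (R s)) (indicatorVec (C s))

/-- The entries of the random matrix `Z` are i.i.d., centred, and sub-Gaussian with parameter
`sig`: `E exp (t z) ≤ exp (sig² t² / (2 a))` for all real `t`, where `a > 0` is the
normalising constant of the definition of sub-Gaussianity. -/
structure IsSubGaussianNoise {Ω : Type*} [MeasurableSpace Ω] (P : Measure Ω) {m n : ℕ}
    (Z : Ω → Matrix (Fin m) (Fin n) ℝ) (a sig : ℝ) : Prop where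
  measurable : ∀ i j, Measurable fun ω => Z ω i j
  indep : iIndepFun (fun (p : Fin m × Fin n) (ω : Ω) => Z ω p.1 p.2) P
  identDistrib : ∀ i j i' j',
    IdentDistrib (fun ω => Z ω i j) (fun ω => Z ω i' j') P P
  mean_zero : ∀ i j, ∫ ω, Z ω i j ∂P = 0
  integrable_exp : ∀ i j (t : ℝ), Integrable (fun ω => Real.exp (t * Z ω i j)) P
  mgf_le : ∀ i j (t : ℝ),
    ∫ ω, Real.exp (t * Z ω i j) ∂P ≤ Real.exp (sig ^ 2 * t ^ 2 / (2 * a))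

/-- `X = U diag(s) Vᵀ` is a (thin) singular value decomposition, with the singular values
listed in nonincreasing order. -/
structure IsSVD {m n : ℕ} (X : Matrix (Fin m) (Fin n) ℝ)
    (U : Matrix (Fin m) (Fin (min m n)) ℝ) (s : Fin (min m n) → ℝ)
    (V : Matrix (Fin n) (Fin (min m n)) ℝ) : Prop where
  left_orthonormal : U.transpose * U = 1
  right_orthonormal : V.transpose * V = 1
  nonneg : ∀ k, 0 ≤ s k
  antitone : Antitone s
  eq : X = U * Matrix.diagonal s * V.transpose

/-- The columns of `U` and `V` are the top `r` left and right singular vectors in some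
singular value decomposition of `X`. -/
def IsTopSingularVectors {m n r : ℕ} (X : Matrix (Fin m) (Fin n) ℝ)
    (U : Matrix (Fin m) (Fin r) ℝ) (V : Matrix (Fin n) (Fin r) ℝ) : Prop :=
  ∃ (h : r ≤ min m n) (U₀ : Matrix (Fin m) (Fin (min m n)) ℝ) (s : Fin (min m n) → ℝ)
    (V₀ : Matrix (Fin n) (Fin (min m n)) ℝ), IsSVD X U₀ s V₀ ∧
      U = U₀.submatrix id (Fin.castLE h) ∧ V = V₀.submatrix id (Fin.castLE h)

/-- The vectors `W (Wᵀ W)⁻¹ Wᵀ Y_{·j}`, `j = 1, …, q`, as points of Euclidean space. -/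
def projectedColumns {p q r : ℕ} (W : Matrix (Fin p) (Fin r) ℝ)
    (Y : Matrix (Fin p) (Fin q) ℝ) : Fin q → EuclideanSpace ℝ (Fin p) :=
  fun j => WithLp.toLp 2
    (Matrix.mulVec (W * (W.transpose * W)⁻¹ * W.transpose) (fun i => Y i j))

/-- The `k`-means objective of the cluster labels `l` and the cluster centres `c`. -/
def kMeansCost {p q k : ℕ} (x : Fin q → EuclideanSpace ℝ (Fin p))
    (l : Fin q → Fin k) (c : Fin k → EuclideanSpace ℝ (Fin p)) : ℝ :=
  ∑ j, ‖x j - c (l j)‖ ^ 2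

/-- `(l, c)` is a `k`-means clustering of the points `x`: a global minimiser of the
`k`-means objective over all labellings and all centres. -/
def IsKMeans {p q k : ℕ} (x : Fin q → EuclideanSpace ℝ (Fin p))
    (l : Fin q → Fin k) (c : Fin k → EuclideanSpace ℝ (Fin p)) : Prop :=
  ∀ (l' : Fin q → Fin k) (c' : Fin k → EuclideanSpace ℝ (Fin p)),
    kMeansCost x l c ≤ kMeansCost x l' c'

/-- A clustering with `r + 1` labels returns exactly the sets `S s`, up to the names of the
labels: the cluster with label `e s` is `S s`, and the one remaining label (the background) is
the one whose centre has the smallest norm. -/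
def Identifies {p q r : ℕ} (l : Fin q → Fin (r + 1))
    (c : Fin (r + 1) → EuclideanSpace ℝ (Fin p)) (S : Fin r → Finset (Fin q)) : Prop :=
  ∃ e : Fin r ↪ Fin (r + 1),
    (∀ s j, l j = e s ↔ j ∈ S s) ∧
      ∀ b, b ∉ Set.range e → ∀ s, ‖c b‖ < ‖c (e s)‖

/-- The spectral algorithm (rank `r` singular projection of the columns and of the rows,
followed by `(r + 1)`-means in each case) run on `X` returns exactly the column supports `C`
and the row supports `R`, whichever singular vectors and whichever minimisers it uses. -/
def SpectralSucceeds {m n r : ℕ} (X : Matrix (Fin m) (Fin n) ℝ)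
    (R : Fin r → Finset (Fin m)) (C : Fin r → Finset (Fin n)) : Prop :=
  ∀ (U : Matrix (Fin m) (Fin r) ℝ) (V : Matrix (Fin n) (Fin r) ℝ),
    IsTopSingularVectors X U V →
      (∀ (l : Fin n → Fin (r + 1)) (c : Fin (r + 1) → EuclideanSpace ℝ (Fin m)),
        IsKMeans (projectedColumns U X) l c → Identifies l c C) ∧
      (∀ (l : Fin m → Fin (r + 1)) (c : Fin (r + 1) → EuclideanSpace ℝ (Fin n)),
        IsKMeans (projectedColumns V X.transpose) l c → Identifies l c R)

end SubmatrixLocalization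

end

/-! Let `M` be the signal, `P` the projection on the top `r` left singular vectors of `X = M + Z`,
`β` a lower bound for the norms of the nonzero columns of `M`, and `Q` one for the sizes of the true
column clusters, background included. The nonzero singular values of `M` are at least `g = β√Q`, and
the signal to noise condition makes `‖Z‖` a small fraction of `g`. The projected data are `P X = M +
E` with `E = P Z - (1 - P) M`, so clustering succeeds if `E` is small in two senses.

Aggregated: `‖E‖ ≤ 3ζ`, where `ζ` bounds `‖Z‖`, so the sum of the deviations over any set `J` of
columns has squared norm at most `(3ζ)² |J|`. Together with a uniform bound on single columns this
is all that `IsKMeans.exists_equiv` needs. It charges each true cluster that is split to a true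
centre that no estimated centre approaches, so nothing is lost as `r` grows.

Column by column: `(1 - P) m_j` is small because `m_j` is repeated at least `Q` times or is zero
(`euclNorm_compl_signal_col_le`). The term `P z_j` is delicate, as `P` depends on `z_j`. With `P_j`
the projection computed after the noise in column `j` is deleted, a one-sided sin Θ bound controls
`(1 - P_j) P` by `(X Xᵀ - X_j X_jᵀ) P`, which again contains `P z_j`; absorbing it gives `‖P z_j‖ ≤
2 ‖P_j z_j‖ + small` (`euclNorm_proj_mulVec_le`). Since `P_j` has rank `r` and is independent of
`z_j`, `‖P_j z_j‖` is of order `σ(√r + √log n)` for all `j` at once (`exists_event`).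

Sub-Gaussian tails for norms come from averaging exponential moments over balls
(`measure_mul_le_of_averaging`). Rows follow by transposing. -/

namespace SubmatrixLocalization

/-! ### Exact recovery by `k`-means -/

/-- Moving the centre away from `θ` on a group of points gains at most the energy of the mean
deviation of the group. -/
lemma neg_le_sum_norm_sub_sq_sub {E : Type*} [NormedAddCommGroup E] [InnerProductSpace ℝ E]
    {ι : Type*} (J : Finset ι) (x : ι → E) (θ c : E) (η : ℝ)
    (h : ‖∑ j ∈ J, (x j - θ)‖ ^ 2 ≤ η ^ 2 * J.card) :
    -η ^ 2 ≤ ∑ j ∈ J, (‖x j - c‖ ^ 2 - ‖x j - θ‖ ^ 2) := by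
  have key : ∑ j ∈ J, (‖x j - c‖ ^ 2 - ‖x j - θ‖ ^ 2)
      = J.card * ‖c - θ‖ ^ 2 - 2 * inner ℝ (∑ j ∈ J, (x j - θ)) (c - θ) := by
    rw [sum_inner, Finset.mul_sum, ← nsmul_eq_mul, ← Finset.sum_const, ← Finset.sum_sub_distrib]
    refine Finset.sum_congr rfl fun j _ => ?_
    have : x j - c = (x j - θ) - (c - θ) := by abel
    rw [this, norm_sub_sq_real]
    ring
  rcases J.eq_empty_or_nonempty with rfl | hJ
  · simpa using sq_nonneg η
  have hp : (0 : ℝ) < J.card := by exact_mod_cast hJ.card_pos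
  have hin := real_inner_le_norm (∑ j ∈ J, (x j - θ)) (c - θ)
  rw [key]
  set Y := ‖∑ j ∈ J, (x j - θ)‖
  -- The right side is `(|J| ‖c - θ‖ - Y)² + (η² |J| - Y²)`.
  have h1 : 0 ≤ (J.card : ℝ) * (J.card * ‖c - θ‖ ^ 2 - 2 * (Y * ‖c - θ‖) + η ^ 2) := by
    nlinarith [sq_nonneg (J.card * ‖c - θ‖ - Y)]
  have h2 := nonneg_of_mul_nonneg_right h1 hp
  linarith

section KMeans

variable {p q k : ℕ} {ι : Type*} [Fintype ι] [DecidableEq ι]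
  {x : Fin q → EuclideanSpace ℝ (Fin p)} {l : Fin q → Fin k}
  {c : Fin k → EuclideanSpace ℝ (Fin p)}

/-- In a `k`-means clustering every point is assigned to a nearest centre. -/
lemma IsKMeans.norm_sub_center_le (h : IsKMeans x l c) (j : Fin q) (b : Fin k) :
    ‖x j - c (l j)‖ ≤ ‖x j - c b‖ := by
  have h1 := h (Function.update l j b) c
  unfold kMeansCost at h1
  rw [← Finset.add_sum_erase _ _ (Finset.mem_univ j),
    ← Finset.add_sum_erase (a := j) Finset.univ
      (fun i => ‖x i - c (Function.update l j b i)‖ ^ 2) (Finset.mem_univ j)] at h1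
  have h2 : ∑ i ∈ Finset.univ.erase j, ‖x i - c (Function.update l j b i)‖ ^ 2
      = ∑ i ∈ Finset.univ.erase j, ‖x i - c (l i)‖ ^ 2 := by
    refine Finset.sum_congr rfl fun i hi => ?_
    rw [Function.update_of_ne (Finset.ne_of_mem_erase hi)]
  rw [h2, Function.update_self] at h1
  exact (sq_le_sq₀ (norm_nonneg _) (norm_nonneg _)).1 (by linarith)

/-- Exact recovery by `k`-means: if the points lie close to well separated true centres `θ`, and
their deviations have small aggregated energy compared with the smallest cluster, then every
`k`-means clustering is the true clustering up to the names of the labels. -/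
theorem IsKMeans.exists_equiv (h : IsKMeans x l c) (t : Fin q → ι)
    (θ : ι → EuclideanSpace ℝ (Fin p)) {Δ η Q : ℝ} (hk : Fintype.card ι = k) (hΔ : 0 < Δ)
    (hQ : 0 < Q) (hsep : ∀ s s', s ≠ s' → Δ ≤ ‖θ s - θ s'‖)
    (hx : ∀ j, ‖x j - θ (t j)‖ ≤ Δ / 16)
    (hη : ∀ J : Finset (Fin q), ‖∑ j ∈ J, (x j - θ (t j))‖ ^ 2 ≤ η ^ 2 * J.card)
    (hsize : ∀ s, Q ≤ ((Finset.univ.filter fun j => t j = s).card : ℝ))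
    (hQη : 2 * η ^ 2 < Q * Δ ^ 2 / 32) :
    ∃ e : ι ≃ Fin k, (∀ j, l j = e (t j)) ∧ ∀ s, ‖c (e s) - θ s‖ ≤ Δ / 4 := by
  classical
  set T : ι → Finset (Fin q) := fun s => Finset.univ.filter fun j => t j = s with hT
  have hmem : ∀ s j, j ∈ T s ↔ t j = s := fun s j => by simp [hT]
  -- `B` is the set of true clusters missed by all estimated centres; the comparison below forces it
  -- to be empty.
  set B : Finset ι := Finset.univ.filter fun s => ∀ b, Δ / 4 < ‖c b - θ s‖ with hB
  -- a point of a cluster with a nearby centre is assigned to a nearby centre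
  have near : ∀ j, t j ∉ B → ‖c (l j) - θ (t j)‖ ≤ 3 * Δ / 8 := by
    intro j hj
    simp only [hB, Finset.mem_filter, Finset.mem_univ, true_and, not_forall, not_lt] at hj
    obtain ⟨b, hb⟩ := hj
    have h1 := h.norm_sub_center_le j b
    have h2 : ‖x j - c b‖ ≤ ‖x j - θ (t j)‖ + ‖c b - θ (t j)‖ := by
      have := norm_sub_le (x j - θ (t j)) (c b - θ (t j))
      simpa using this
    have h3 : ‖c (l j) - θ (t j)‖ ≤ ‖x j - θ (t j)‖ + ‖x j - c (l j)‖ := by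
      have := norm_sub_le (x j - θ (t j)) (x j - c (l j))
      simpa using this
    linarith [hx j]
  -- A centre this close to two true centres would put them at distance at most `3Δ/4 < Δ`.
  have uniq : ∀ b s s', ‖c b - θ s‖ ≤ 3 * Δ / 8 → ‖c b - θ s'‖ ≤ 3 * Δ / 8 → s = s' := by
    intro b s s' h1 h2
    by_contra hne
    have h3 := hsep s s' hne
    have h4 : ‖θ s - θ s'‖ ≤ ‖c b - θ s'‖ + ‖c b - θ s‖ := by
      have := norm_sub_le (c b - θ s') (c b - θ s)
      simpa using this
    linarith
  set Lb : ι → Finset (Fin k) := fun s => (T s).image l with hLb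
  have hTne : ∀ s, (T s).Nonempty := by
    intro s
    rw [← Finset.card_pos]
    have := hsize s
    exact_mod_cast hQ.trans_le this
  have hη' : ∀ s (J : Finset (Fin q)), J ⊆ T s →
      ‖∑ j ∈ J, (x j - θ s)‖ ^ 2 ≤ η ^ 2 * J.card := by
    intro s J hJ
    have : ∑ j ∈ J, (x j - θ s) = ∑ j ∈ J, (x j - θ (t j)) :=
      Finset.sum_congr rfl fun j hj => by rw [(hmem s j).1 (hJ hj)]
    rw [this]
    exact hη J
  -- An unsplit cluster keeps its estimated centre and loses nothing. A split one is recentred at `θ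
  -- s`, losing at most `η²` per piece, and a number of pieces that is at least 2 is at most twice
  -- itself minus one.
  have good : ∀ s, ∃ c', s ∉ B →
      -(2 * (((Lb s).card : ℝ) - 1) * η ^ 2) ≤
        ∑ j ∈ T s, (‖x j - c (l j)‖ ^ 2 - ‖x j - c'‖ ^ 2) := by
    intro s
    have hLne : 1 ≤ (Lb s).card := Finset.card_pos.2 ((hTne s).image l)
    rcases hLne.eq_or_lt with h1 | h1
    · obtain ⟨b, hb⟩ := Finset.card_eq_one.1 h1.symm
      refine ⟨c b, fun _ => ?_⟩
      rw [← h1, Finset.sum_eq_zero]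
      · simp
      · intro j hj
        have : l j ∈ Lb s := Finset.mem_image_of_mem l hj
        rw [hb, Finset.mem_singleton] at this
        rw [this, sub_self]
    · refine ⟨θ s, fun _ => ?_⟩
      rw [← Finset.sum_fiberwise_of_maps_to (t := Lb s) (g := l)
        (fun j hj => Finset.mem_image_of_mem l hj)]
      have h2 : ∀ b ∈ Lb s, -η ^ 2 ≤
          ∑ j ∈ T s with l j = b, (‖x j - c (l j)‖ ^ 2 - ‖x j - θ s‖ ^ 2) := by
        intro b _
        have h3 := neg_le_sum_norm_sub_sq_sub ((T s).filter fun j => l j = b) x (θ s) (c b) η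
          (hη' s _ (Finset.filter_subset _ _))
        refine h3.trans_eq (Finset.sum_congr rfl fun j hj => ?_)
        rw [(Finset.mem_filter.1 hj).2]
      have h4 := Finset.card_nsmul_le_sum _ _ _ h2
      rw [nsmul_eq_mul] at h4
      refine le_trans ?_ h4
      have h5 : (2 : ℝ) ≤ (Lb s).card := by exact_mod_cast h1
      nlinarith [sq_nonneg η]
  -- Each point of a missed cluster is at least `Δ/4 - Δ/16 = 3Δ/16` from its centre, and `(3/16)² -
  -- (1/16)² = 1/32`.
  have bad : ∀ s ∈ B, Q * Δ ^ 2 / 32 ≤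
      ∑ j ∈ T s, (‖x j - c (l j)‖ ^ 2 - ‖x j - θ s‖ ^ 2) := by
    intro s hs
    have h1 : ∀ j ∈ T s, Δ ^ 2 / 32 ≤ ‖x j - c (l j)‖ ^ 2 - ‖x j - θ s‖ ^ 2 := by
      intro j hj
      have hxj := hx j
      rw [(hmem s j).1 hj] at hxj
      have h2 := (Finset.mem_filter.1 hs).2 (l j)
      have h3 : ‖c (l j) - θ s‖ ≤ ‖x j - θ s‖ + ‖x j - c (l j)‖ := by
        have := norm_sub_le (x j - θ s) (x j - c (l j))
        simpa using this
      have h4 : 3 * Δ / 16 ≤ ‖x j - c (l j)‖ := by linarith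
      nlinarith [norm_nonneg (x j - θ s)]
    have h4 := Finset.card_nsmul_le_sum _ _ _ h1
    rw [nsmul_eq_mul] at h4
    refine le_trans ?_ h4
    have := hsize s
    nlinarith [sq_nonneg Δ]
  choose c₁ hc₁ using good
  set c' : ι → EuclideanSpace ℝ (Fin p) := fun s => if s ∈ B then θ s else c₁ s with hc'
  let e₀ : ι ≃ Fin k := Fintype.equivFinOfCardEq hk
  have hopt : ∑ s, ∑ j ∈ T s, (‖x j - c (l j)‖ ^ 2 - ‖x j - c' s‖ ^ 2) ≤ 0 := by
    have h1 := h (fun j => e₀ (t j)) (fun b => c' (e₀.symm b))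
    unfold kMeansCost at h1
    simp only [Equiv.symm_apply_apply] at h1
    have h2 : ∑ s, ∑ j ∈ T s, (‖x j - c (l j)‖ ^ 2 - ‖x j - c' s‖ ^ 2)
        = ∑ j, (‖x j - c (l j)‖ ^ 2 - ‖x j - c' (t j)‖ ^ 2) := by
      rw [← Finset.sum_fiberwise (s := Finset.univ) (g := t)]
      refine Finset.sum_congr rfl fun s _ => Finset.sum_congr rfl fun j hj => ?_
      rw [(hmem s j).1 hj]
    rw [h2, Finset.sum_sub_distrib]
    linarith
  have hlow : ∀ s, (if s ∈ B then Q * Δ ^ 2 / 32 else -(2 * (((Lb s).card : ℝ) - 1) * η ^ 2)) ≤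
      ∑ j ∈ T s, (‖x j - c (l j)‖ ^ 2 - ‖x j - c' s‖ ^ 2) := by
    intro s
    by_cases hs : s ∈ B
    · simpa [hc', hs] using bad s hs
    · simpa [hc', hs] using hc₁ s hs
  -- Clusters outside `B` use disjoint sets of labels. Since there are as many labels as clusters,
  -- the excess `∑ (|Lb s| - 1)` over `Bᶜ` is at most `|B|`: splits are paid for by missed clusters.
  have hcardL : ∑ s ∈ Bᶜ, (Lb s).card ≤ k := by
    rw [← Finset.card_biUnion]
    · simpa using Finset.card_le_univ (Bᶜ.biUnion Lb)
    · intro s hs s' hs' hne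
      refine Finset.disjoint_left.2 fun b hb hb' => ?_
      simp only [hLb, Finset.mem_image] at hb hb'
      obtain ⟨j, hj, rfl⟩ := hb
      obtain ⟨j', hj', hjj⟩ := hb'
      apply hne
      rw [hmem] at hj hj'
      refine uniq (l j) s s' ?_ ?_
      · rw [← hj]
        exact near j (by rw [hj]; simpa using hs)
      · rw [← hjj, ← hj']
        exact near j' (by rw [hj']; simpa using hs')
  have hBempty : B = ∅ := by
    by_contra hne
    have hBpos : (0 : ℝ) < B.card := by
      exact_mod_cast Finset.card_pos.2 (Finset.nonempty_iff_ne_empty.2 hne)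
    have h1 := (Finset.sum_le_sum fun s (_ : s ∈ Finset.univ) => hlow s).trans hopt
    rw [Finset.sum_ite] at h1
    have e1 : Finset.univ.filter (fun s => s ∈ B) = B := by ext; simp
    have e2 : Finset.univ.filter (fun s => s ∉ B) = Bᶜ := by ext; simp
    rw [e1, e2, Finset.sum_const, nsmul_eq_mul, Finset.sum_neg_distrib, ← Finset.sum_mul,
      ← Finset.mul_sum, Finset.sum_sub_distrib, Finset.sum_const, nsmul_eq_mul, mul_one] at h1
    have h2 : (∑ s ∈ Bᶜ, ((Lb s).card : ℝ)) ≤ k := by exact_mod_cast hcardL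
    have h3 : ((Bᶜ).card : ℝ) = k - B.card := by
      rw [Finset.card_compl, hk, Nat.cast_sub (hk ▸ Finset.card_le_univ B)]
    rw [h3] at h1
    have h4 : (∑ s ∈ Bᶜ, ((Lb s).card : ℝ)) - (k - B.card) ≤ B.card := by linarith
    nlinarith [mul_le_mul_of_nonneg_right h4 (sq_nonneg η), mul_lt_mul_of_pos_left hQη hBpos]
  have hnear : ∀ s, ∃ b, ‖c b - θ s‖ ≤ Δ / 4 := by
    intro s
    have : s ∉ B := by simp [hBempty]
    simpa [hB] using this
  choose f hf using hnear
  have hinj : Function.Injective f := by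
    intro s s' hss
    refine uniq (f s) s s' ?_ ?_
    · linarith [hf s]
    · rw [hss]; linarith [hf s']
  have hbij : Function.Bijective f :=
    (Fintype.bijective_iff_injective_and_card f).2 ⟨hinj, by simp [hk]⟩
  refine ⟨Equiv.ofBijective f hbij, fun j => ?_, hf⟩
  obtain ⟨s', hs'⟩ := hbij.2 (l j)
  have : s' = t j := by
    refine uniq (l j) s' (t j) ?_ (near j (by simp [hBempty]))
    rw [← hs']; linarith [hf s']
  rw [← hs', this]
  rfl

end KMeans

/-! ### Euclidean norms of vectors and operator norms of matrices -/

open scoped Matrix Matrix.Norms.L2Operator ENNReal NNReal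

section EuclNorm

variable {ι κ ν : Type*} [Fintype ι] [Fintype κ] [Fintype ν]

/-- The Euclidean norm of a plain vector. -/
noncomputable def euclNorm (v : ι → ℝ) : ℝ := ‖WithLp.toLp 2 v‖

lemma euclNorm_nonneg (v : ι → ℝ) : 0 ≤ euclNorm v := norm_nonneg _

lemma euclNorm_sq (v : ι → ℝ) : euclNorm v ^ 2 = ∑ i, v i ^ 2 := by
  simp [euclNorm, EuclideanSpace.norm_sq_eq]

lemma euclNorm_sq_eq_dotProduct (v : ι → ℝ) : euclNorm v ^ 2 = v ⬝ᵥ v := by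
  rw [euclNorm_sq, dotProduct]
  simp [sq]

lemma dotProduct_le_euclNorm_mul (v w : ι → ℝ) : v ⬝ᵥ w ≤ euclNorm v * euclNorm w := by
  have := real_inner_le_norm (WithLp.toLp 2 w) (WithLp.toLp 2 v)
  rw [EuclideanSpace.inner_toLp_toLp, star_trivial, mul_comm] at this
  exact this

lemma euclNorm_add_le (v w : ι → ℝ) : euclNorm (v + w) ≤ euclNorm v + euclNorm w :=
  norm_add_le _ _

lemma euclNorm_sub_le (v w : ι → ℝ) : euclNorm (v - w) ≤ euclNorm v + euclNorm w :=
  norm_sub_le _ _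

lemma euclNorm_smul (t : ℝ) (v : ι → ℝ) : euclNorm (t • v) = |t| * euclNorm v :=
  norm_smul t (WithLp.toLp 2 v)

lemma euclNorm_eq_zero {v : ι → ℝ} : euclNorm v = 0 ↔ v = 0 := by
  simp [euclNorm]

lemma euclNorm_pos {v : ι → ℝ} (hv : v ≠ 0) : 0 < euclNorm v :=
  lt_of_le_of_ne (euclNorm_nonneg v) fun h => hv (euclNorm_eq_zero.1 h.symm)

lemma euclNorm_mulVec_le [DecidableEq κ] (A : Matrix ι κ ℝ) (v : κ → ℝ) :
    euclNorm (A *ᵥ v) ≤ ‖A‖ * euclNorm v :=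
  Matrix.l2_opNorm_mulVec A (WithLp.toLp 2 v)

lemma opNorm_le_of_euclNorm_le [DecidableEq κ] (A : Matrix ι κ ℝ) {K : ℝ} (hK : 0 ≤ K)
    (h : ∀ v, euclNorm (A *ᵥ v) ≤ K * euclNorm v) : ‖A‖ ≤ K := by
  rw [Matrix.l2_opNorm_def]
  exact ContinuousLinearMap.opNorm_le_bound _ hK fun v => h (WithLp.ofLp v)

lemma opNorm_transpose [DecidableEq ι] [DecidableEq κ] (A : Matrix ι κ ℝ) : ‖Aᵀ‖ = ‖A‖ := by
  rw [← Matrix.conjTranspose_eq_transpose_of_trivial, Matrix.l2_opNorm_conjTranspose]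

lemma opNorm_transpose_mul_self [DecidableEq ι] [DecidableEq κ] (A : Matrix ι κ ℝ) :
    ‖Aᵀ * A‖ = ‖A‖ ^ 2 := by
  rw [← Matrix.conjTranspose_eq_transpose_of_trivial, Matrix.l2_opNorm_conjTranspose_mul_self, sq]

lemma opNorm_mul_transpose_self [DecidableEq ι] [DecidableEq κ] (A : Matrix ι κ ℝ) :
    ‖A * Aᵀ‖ = ‖A‖ ^ 2 := by
  have := opNorm_transpose_mul_self Aᵀ
  rwa [Matrix.transpose_transpose, opNorm_transpose] at this

lemma opNorm_one_le [DecidableEq ι] : ‖(1 : Matrix ι ι ℝ)‖ ≤ 1 := by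
  refine opNorm_le_of_euclNorm_le _ zero_le_one fun v => ?_
  simp

lemma opNorm_le_one_of_transpose_mul_self [DecidableEq ι] [DecidableEq κ] {U : Matrix ι κ ℝ}
    (hU : Uᵀ * U = 1) : ‖U‖ ≤ 1 := by
  have h := opNorm_transpose_mul_self U
  rw [hU] at h
  have h1 : ‖(1 : Matrix κ κ ℝ)‖ ≤ 1 := opNorm_one_le
  nlinarith [norm_nonneg U]

lemma euclNorm_mulVec_of_transpose_mul_self [DecidableEq κ] {U : Matrix ι κ ℝ}
    (hU : Uᵀ * U = 1) (v : κ → ℝ) : euclNorm (U *ᵥ v) = euclNorm v := by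
  rw [← sq_eq_sq₀ (euclNorm_nonneg _) (euclNorm_nonneg _), euclNorm_sq_eq_dotProduct,
    euclNorm_sq_eq_dotProduct, Matrix.dotProduct_mulVec, Matrix.vecMul_mulVec, hU,
    Matrix.vecMul_one]

lemma opNorm_vecMulVec_le [DecidableEq κ] (v : ι → ℝ) (w : κ → ℝ) :
    ‖Matrix.vecMulVec v w‖ ≤ euclNorm v * euclNorm w := by
  refine opNorm_le_of_euclNorm_le _ (mul_nonneg (euclNorm_nonneg _) (euclNorm_nonneg _))
    fun u => ?_
  have h1 : Matrix.vecMulVec v w *ᵥ u = (w ⬝ᵥ u) • v := by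
    rw [Matrix.vecMulVec_mulVec]
    ext i; simp [mul_comm]
  have h2 : |w ⬝ᵥ u| ≤ euclNorm w * euclNorm u := by
    rw [abs_le]
    refine ⟨?_, dotProduct_le_euclNorm_mul w u⟩
    have h3 := dotProduct_le_euclNorm_mul (-w) u
    have h4 : euclNorm (-w) = euclNorm w := norm_neg (WithLp.toLp 2 w)
    rw [h4, neg_dotProduct] at h3
    linarith
  rw [h1, euclNorm_smul]
  nlinarith [mul_le_mul_of_nonneg_right h2 (euclNorm_nonneg v)]

lemma opNorm_diagonal_le [DecidableEq κ] (d : κ → ℝ) {K : ℝ} (hK : 0 ≤ K) (h : ∀ i, |d i| ≤ K) :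
    ‖Matrix.diagonal d‖ ≤ K := by
  rw [Matrix.l2_opNorm_diagonal]
  exact (pi_norm_le_iff_of_nonneg hK).2 h

/-- Conjugating a diagonal matrix by orthonormal columns does not increase its norm. -/
lemma opNorm_mul_diagonal_mul_transpose_le [DecidableEq ι] [DecidableEq κ] {U : Matrix ι κ ℝ}
    (hU : Uᵀ * U = 1) (d : κ → ℝ) {K : ℝ} (hK : 0 ≤ K) (h : ∀ i, |d i| ≤ K) :
    ‖U * Matrix.diagonal d * Uᵀ‖ ≤ K := by
  have hU1 := opNorm_le_one_of_transpose_mul_self hU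
  have hd := opNorm_diagonal_le d hK h
  calc ‖U * Matrix.diagonal d * Uᵀ‖ ≤ ‖U * Matrix.diagonal d‖ * ‖Uᵀ‖ := Matrix.l2_opNorm_mul _ _
    _ ≤ (‖U‖ * ‖Matrix.diagonal d‖) * ‖Uᵀ‖ := by gcongr; exact Matrix.l2_opNorm_mul _ _
    _ ≤ (1 * K) * 1 := by rw [opNorm_transpose]; gcongr
    _ = K := by ring

end EuclNorm

/-! ### Spectral projections and their perturbation -/

section SpectralGap

variable {p : ℕ}

/-- `S = U₀ diag(μ) U₀ᵀ` with orthonormal columns `U₀` and nonincreasing nonnegative `μ`. -/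
structure IsOrderedEigen {N : ℕ} (S : Matrix (Fin p) (Fin p) ℝ) (U₀ : Matrix (Fin p) (Fin N) ℝ)
    (μ : Fin N → ℝ) : Prop where
  orthonormal : U₀ᵀ * U₀ = 1
  nonneg : ∀ i, 0 ≤ μ i
  antitone : Antitone μ
  eq : S = U₀ * Matrix.diagonal μ * U₀ᵀ

/-- The orthogonal projection on the span of the first `r` columns of `U₀`. -/
noncomputable def topProj {N : ℕ} (r : ℕ) (U₀ : Matrix (Fin p) (Fin N) ℝ) :
    Matrix (Fin p) (Fin p) ℝ :=
  U₀ * Matrix.diagonal (fun i : Fin N => if i.val < r then (1 : ℝ) else 0) * U₀ᵀ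

/-- `P` is a spectral projection of `S` that separates the spectrum above `Θ` from the spectrum
below `T`. -/
structure IsSpectralSplit (S P : Matrix (Fin p) (Fin p) ℝ) (Θ T : ℝ) : Prop where
  norm_le : ‖P‖ ≤ 1
  norm_compl_le : ‖1 - P‖ ≤ 1
  symm : Pᵀ = P
  idem : P * P = P
  exists_inv : ∃ G, S * G = P ∧ P * G = G ∧ ‖G‖ ≤ Θ⁻¹
  compl_mul_compl : (1 - P) * S * (1 - P) = (1 - P) * S
  norm_compl_mul_le : ‖(1 - P) * S‖ ≤ T

lemma mul_diagonal_mul_transpose_mul {N : ℕ} {U₀ : Matrix (Fin p) (Fin N) ℝ}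
    (hU : U₀ᵀ * U₀ = 1) (d e : Fin N → ℝ) :
    (U₀ * Matrix.diagonal d * U₀ᵀ) * (U₀ * Matrix.diagonal e * U₀ᵀ)
      = U₀ * Matrix.diagonal (fun i => d i * e i) * U₀ᵀ := by
  calc _ = U₀ * Matrix.diagonal d * (U₀ᵀ * U₀) * Matrix.diagonal e * U₀ᵀ := by
        simp only [Matrix.mul_assoc]
    _ = _ := by
        rw [hU, Matrix.mul_one, Matrix.mul_assoc U₀, Matrix.diagonal_mul_diagonal]

lemma opNorm_le_one_of_idem {P : Matrix (Fin p) (Fin p) ℝ} (hs : Pᵀ = P) (hi : P * P = P) :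
    ‖P‖ ≤ 1 := by
  have h := opNorm_transpose_mul_self P
  rw [hs, hi] at h
  nlinarith [norm_nonneg P]

lemma IsOrderedEigen.isSpectralSplit {N r : ℕ} {S : Matrix (Fin p) (Fin p) ℝ}
    {U₀ : Matrix (Fin p) (Fin N) ℝ} {μ : Fin N → ℝ} (h : IsOrderedEigen S U₀ μ) {Θ T : ℝ}
    (hΘ : 0 < Θ) (hT : 0 ≤ T) (htop : ∀ i : Fin N, i.val < r → Θ ≤ μ i)
    (hlow : ∀ i : Fin N, r ≤ i.val → μ i ≤ T) :
    IsSpectralSplit S (topProj r U₀) Θ T := by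
  have hU := h.orthonormal
  have hs : (topProj r U₀)ᵀ = topProj r U₀ := by
    simp [topProj, Matrix.transpose_mul, Matrix.mul_assoc]
  have hi : topProj r U₀ * topProj r U₀ = topProj r U₀ := by
    unfold topProj
    rw [mul_diagonal_mul_transpose_mul hU]
    congr 3
    ext i; split_ifs <;> simp
  have hPS : (1 - topProj r U₀) * S
      = U₀ * Matrix.diagonal (fun i : Fin N => if i.val < r then 0 else μ i) * U₀ᵀ := by
    rw [Matrix.sub_mul, Matrix.one_mul, h.eq, topProj, mul_diagonal_mul_transpose_mul hU,
      ← Matrix.sub_mul, ← Matrix.mul_sub, Matrix.diagonal_sub]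
    congr 3
    ext i; split_ifs <;> simp
  have hSP : S * topProj r U₀ = topProj r U₀ * S := by
    rw [h.eq, topProj, mul_diagonal_mul_transpose_mul hU, mul_diagonal_mul_transpose_mul hU]
    simp only [mul_comm]
  have hi' : (1 - topProj r U₀) * (1 - topProj r U₀) = 1 - topProj r U₀ := by
    rw [Matrix.mul_sub, Matrix.mul_one, Matrix.sub_mul, Matrix.one_mul, hi, sub_self, sub_zero]
  refine ⟨opNorm_le_one_of_idem hs hi, opNorm_le_one_of_idem ?_ hi', hs, hi, ?_, ?_, ?_⟩
  · rw [Matrix.transpose_sub, hs, Matrix.transpose_one]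
  -- The witness inverts `S` on the range of the projection and vanishes on its complement.
  · refine ⟨U₀ * Matrix.diagonal (fun i : Fin N => if i.val < r then (μ i)⁻¹ else 0) * U₀ᵀ,
      ?_, ?_, ?_⟩
    · rw [h.eq, topProj, mul_diagonal_mul_transpose_mul hU]
      congr 3
      ext i
      split_ifs with hir
      · exact mul_inv_cancel₀ (hΘ.trans_le (htop i hir)).ne'
      · simp
    · rw [topProj, mul_diagonal_mul_transpose_mul hU]
      congr 3
      ext i; split_ifs <;> simp
    · refine opNorm_mul_diagonal_mul_transpose_le hU _ (inv_nonneg.2 hΘ.le) fun i => ?_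
      split_ifs with hir
      · rw [abs_of_nonneg (inv_nonneg.2 (h.nonneg i))]
        exact inv_anti₀ hΘ (htop i hir)
      · simpa using hΘ.le
  · have hcomm : S * (1 - topProj r U₀) = (1 - topProj r U₀) * S := by
      rw [Matrix.mul_sub, Matrix.sub_mul, hSP, Matrix.mul_one, Matrix.one_mul]
    rw [Matrix.mul_assoc, hcomm, ← Matrix.mul_assoc, hi']
  · rw [hPS]
    refine opNorm_mul_diagonal_mul_transpose_le hU _ hT fun i => ?_
    split_ifs with hir
    · simpa using hT
    · rw [abs_of_nonneg (h.nonneg i)]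
      exact hlow i (not_lt.1 hir)

/-- A one-sided `sin Θ` theorem: the spectral projections of nearby symmetric matrices are
close. -/
lemma IsSpectralSplit.norm_compl_mul_le_of_perturb {S P S' P' : Matrix (Fin p) (Fin p) ℝ}
    {Θ T : ℝ} (hΘ : 0 < Θ) (h : IsSpectralSplit S P Θ T) (h' : IsSpectralSplit S' P' Θ T) :
    (Θ - T) * ‖(1 - P') * P‖ ≤ ‖(S - S') * P‖ := by
  obtain ⟨G, hSG, hPG, hG⟩ := h.exists_inv
  -- Write `P = S G` and `S = S' + (S - S')`. The `S'` part reproduces `(1 - P') P` with factor at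
  -- most `T/Θ`. The other part keeps the factor `P`, which the leave-one-out argument relies on.
  have key : (1 - P') * P
      = ((1 - P') * S') * ((1 - P') * P) * G + (1 - P') * ((S - S') * P) * G := by
    have e1 : ((1 - P') * S') * ((1 - P') * P) * G = (1 - P') * S' * (P * G) := by
      rw [← Matrix.mul_assoc ((1 - P') * S'), h'.compl_mul_compl, Matrix.mul_assoc]
    have e2 : (1 - P') * ((S - S') * P) * G = (1 - P') * (S - S') * (P * G) := by
      simp only [Matrix.mul_assoc]
    have e3 : (1 - P') * P = (1 - P') * S * G := by rw [Matrix.mul_assoc, hSG]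
    rw [e1, e2, hPG, e3, Matrix.mul_sub (1 - P') S S', Matrix.sub_mul ((1 - P') * S),
      add_sub_cancel]
  have hb : ‖(1 - P') * P‖ ≤ (T * ‖(1 - P') * P‖ + ‖(S - S') * P‖) * Θ⁻¹ := by
    have n1 : ‖((1 - P') * S') * ((1 - P') * P) * G‖ ≤ T * ‖(1 - P') * P‖ * Θ⁻¹ :=
      calc _ ≤ ‖((1 - P') * S') * ((1 - P') * P)‖ * ‖G‖ := norm_mul_le _ _
        _ ≤ (‖(1 - P') * S'‖ * ‖(1 - P') * P‖) * ‖G‖ := by gcongr; exact norm_mul_le _ _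
        _ ≤ T * ‖(1 - P') * P‖ * Θ⁻¹ := by
          have := h'.norm_compl_mul_le
          have hT : 0 ≤ T := (norm_nonneg _).trans this
          gcongr
    have n2 : ‖(1 - P') * ((S - S') * P) * G‖ ≤ ‖(S - S') * P‖ * Θ⁻¹ :=
      calc _ ≤ ‖(1 - P') * ((S - S') * P)‖ * ‖G‖ := norm_mul_le _ _
        _ ≤ (‖1 - P'‖ * ‖(S - S') * P‖) * ‖G‖ := by gcongr; exact norm_mul_le _ _
        _ ≤ (1 * ‖(S - S') * P‖) * Θ⁻¹ := by
          have := h'.norm_compl_le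
          gcongr
        _ = _ := by ring
    have n3 := norm_add_le (((1 - P') * S') * ((1 - P') * P) * G)
      ((1 - P') * ((S - S') * P) * G)
    rw [← key] at n3
    linarith
  have := mul_le_mul_of_nonneg_left hb hΘ.le
  rw [mul_comm _ Θ⁻¹, ← mul_assoc, mul_inv_cancel₀ hΘ.ne', one_mul] at this
  linarith

/-- The one-sided bounds in both directions combine since `P - P' = (1 - P') P - ((1 - P) P')ᵀ`.
This cruder form serves to make the projection continuous in the matrix. -/
lemma IsSpectralSplit.norm_sub_le {S P S' P' : Matrix (Fin p) (Fin p) ℝ}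
    {Θ T : ℝ} (hΘ : 0 < Θ) (h : IsSpectralSplit S P Θ T) (h' : IsSpectralSplit S' P' Θ T) :
    (Θ - T) * ‖P - P'‖ ≤ 2 * ‖S - S'‖ := by
  have hTT : Θ ≤ T ∨ T < Θ := le_or_gt _ _
  rcases hTT with hTT | hTT
  · nlinarith [norm_nonneg (P - P'), norm_nonneg (S - S')]
  have h1 := h.norm_compl_mul_le_of_perturb hΘ h'
  have h2 := h'.norm_compl_mul_le_of_perturb hΘ h
  have e : P - P' = (1 - P') * P - ((1 - P) * P')ᵀ := by
    rw [Matrix.transpose_mul, Matrix.transpose_sub, h.symm, h'.symm, Matrix.transpose_one]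
    noncomm_ring
  have h3 := _root_.norm_sub_le ((1 - P') * P) ((1 - P) * P')ᵀ
  rw [← e, opNorm_transpose] at h3
  have h4 : ‖(S - S') * P‖ ≤ ‖S - S'‖ :=
    (norm_mul_le _ _).trans (mul_le_of_le_one_right (norm_nonneg _) h.norm_le)
  have h5 : ‖(S' - S) * P'‖ ≤ ‖S - S'‖ := by
    rw [norm_sub_rev S S']
    exact (norm_mul_le _ _).trans (mul_le_of_le_one_right (norm_nonneg _) h'.norm_le)
  have := mul_le_mul_of_nonneg_left h3 (sub_nonneg.2 hTT.le)
  linarith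

end SpectralGap

/-! ### Eigenvalue bounds by the min-max principle -/

section Weyl

variable {p q N r : ℕ}

lemma IsOrderedEigen.euclNorm_sq {X : Matrix (Fin p) (Fin q) ℝ} {U₀ : Matrix (Fin p) (Fin N) ℝ}
    {μ : Fin N → ℝ} (h : IsOrderedEigen (X * Xᵀ) U₀ μ) (v : Fin p → ℝ) :
    euclNorm (Xᵀ *ᵥ v) ^ 2 = ∑ i, μ i * (U₀ᵀ *ᵥ v) i ^ 2 := by
  have h1 : euclNorm (Xᵀ *ᵥ v) ^ 2 = v ⬝ᵥ ((X * Xᵀ) *ᵥ v) := by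
    rw [euclNorm_sq_eq_dotProduct, Matrix.dotProduct_mulVec, Matrix.vecMul_transpose,
      Matrix.mulVec_mulVec, dotProduct_comm]
  have h2 : v ⬝ᵥ ((U₀ * Matrix.diagonal μ * U₀ᵀ) *ᵥ v)
      = (U₀ᵀ *ᵥ v) ⬝ᵥ (Matrix.diagonal μ *ᵥ (U₀ᵀ *ᵥ v)) := by
    rw [← Matrix.mulVec_mulVec, ← Matrix.mulVec_mulVec, Matrix.dotProduct_mulVec,
      ← Matrix.mulVec_transpose]
  rw [h1, h.eq, h2, dotProduct]
  refine Finset.sum_congr rfl fun i _ => ?_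
  rw [Matrix.mulVec_diagonal]
  ring

lemma exists_ne_zero_of_card_lt {V W : Type*} [AddCommGroup V] [Module ℝ V] [AddCommGroup W]
    [Module ℝ W] [FiniteDimensional ℝ V] [FiniteDimensional ℝ W] (f : V →ₗ[ℝ] W)
    (h : Module.finrank ℝ W < Module.finrank ℝ V) : ∃ v, v ≠ 0 ∧ f v = 0 := by
  obtain ⟨v, hv, hne⟩ := (Submodule.ne_bot_iff _).1 (LinearMap.ker_ne_bot_of_finrank_lt h)
  exact ⟨v, hne, hv⟩

/-- The range of `F` has dimension `r > i`, so it contains a nonzero vector orthogonal to the first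
`i` eigenvectors. On it `Xᵀ` stretches by at most `√(μ i)`, and by at least `g - ζ`. -/
lemma IsOrderedEigen.le_of_lt {X M Z : Matrix (Fin p) (Fin q) ℝ}
    {U₀ : Matrix (Fin p) (Fin N) ℝ} {μ : Fin N → ℝ} (h : IsOrderedEigen (X * Xᵀ) U₀ μ)
    (hX : X = M + Z) {F : Matrix (Fin p) (Fin r) ℝ} {g ζ : ℝ}
    (hF : ∀ a, F *ᵥ a = 0 → a = 0)
    (hM : ∀ a, g * euclNorm (F *ᵥ a) ≤ euclNorm (Mᵀ *ᵥ (F *ᵥ a)))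
    (hζ : ‖Z‖ ≤ ζ) (hgζ : ζ ≤ g) (i : Fin N) (hi : i.val < r) : (g - ζ) ^ 2 ≤ μ i := by
  obtain ⟨a, ha, hfa⟩ := exists_ne_zero_of_card_lt
    ((LinearMap.funLeft ℝ ℝ (Subtype.val : {k : Fin N // k < i} → Fin N)).comp
      (Matrix.mulVecLin (U₀ᵀ * F))) (by
        rw [Module.finrank_fintype_fun_eq_card, Module.finrank_fintype_fun_eq_card,
          Fintype.card_fin, Fintype.card_subtype]
        have : (Finset.univ.filter fun k => k < i) = Finset.Iio i := by ext; simp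
        rw [this, Fin.card_Iio]
        exact hi)
  set v := F *ᵥ a with hv
  have hv0 : v ≠ 0 := fun h0 => ha (hF a h0)
  have hpos := euclNorm_pos hv0
  have hz : ∀ k < i, (U₀ᵀ *ᵥ v) k = 0 := by
    intro k hk
    rw [hv, Matrix.mulVec_mulVec]
    exact congrFun hfa ⟨k, hk⟩
  have h1 : euclNorm (Xᵀ *ᵥ v) ^ 2 ≤ μ i * euclNorm v ^ 2 := by
    rw [h.euclNorm_sq]
    have h2 : euclNorm (U₀ᵀ *ᵥ v) ≤ euclNorm v := by
      refine (euclNorm_mulVec_le _ _).trans ?_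
      rw [opNorm_transpose]
      exact mul_le_of_le_one_left hpos.le (opNorm_le_one_of_transpose_mul_self h.orthonormal)
    calc ∑ k, μ k * (U₀ᵀ *ᵥ v) k ^ 2 ≤ ∑ k, μ i * (U₀ᵀ *ᵥ v) k ^ 2 := by
          refine Finset.sum_le_sum fun k _ => ?_
          rcases lt_or_ge k i with hk | hk
          · simp [hz k hk]
          · exact mul_le_mul_of_nonneg_right (h.antitone hk) (sq_nonneg _)
      _ = μ i * euclNorm (U₀ᵀ *ᵥ v) ^ 2 := by rw [← Finset.mul_sum, SubmatrixLocalization.euclNorm_sq]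
      _ ≤ μ i * euclNorm v ^ 2 := by
          have := h.nonneg i
          have := euclNorm_nonneg (U₀ᵀ *ᵥ v)
          gcongr
  have h3 : (g - ζ) * euclNorm v ≤ euclNorm (Xᵀ *ᵥ v) := by
    have e : Mᵀ *ᵥ v = Xᵀ *ᵥ v - Zᵀ *ᵥ v := by
      rw [hX, Matrix.transpose_add, Matrix.add_mulVec]; abel
    have h4 := hM a
    rw [← hv, e] at h4
    have h5 := euclNorm_sub_le (Xᵀ *ᵥ v) (Zᵀ *ᵥ v)
    have h6 := euclNorm_mulVec_le Zᵀ v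
    rw [opNorm_transpose] at h6
    nlinarith
  have h7 : ((g - ζ) * euclNorm v) ^ 2 ≤ euclNorm (Xᵀ *ᵥ v) ^ 2 :=
    pow_le_pow_left₀ (mul_nonneg (sub_nonneg.2 hgζ) hpos.le) h3 2
  rw [mul_pow] at h7
  exact le_of_mul_le_mul_right (h7.trans h1) (by positivity)

/-- The span of the first `i + 1 > r` eigenvectors contains a nonzero vector killed by `Fᵀ`, hence
by `Mᵀ`; there `Xᵀ` acts as `Zᵀ` and stretches by at least `√(μ i)`. -/
lemma IsOrderedEigen.le_of_ge {X M Z : Matrix (Fin p) (Fin q) ℝ}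
    {U₀ : Matrix (Fin p) (Fin N) ℝ} {μ : Fin N → ℝ} (h : IsOrderedEigen (X * Xᵀ) U₀ μ)
    (hX : X = M + Z) {F : Matrix (Fin p) (Fin r) ℝ} {ζ : ℝ}
    (hker : ∀ v, Fᵀ *ᵥ v = 0 → Mᵀ *ᵥ v = 0)
    (hζ : ‖Z‖ ≤ ζ) (i : Fin N) (hi : r ≤ i.val) : μ i ≤ ζ ^ 2 := by
  obtain ⟨b, hb, hfb⟩ := exists_ne_zero_of_card_lt
    ((LinearMap.funLeft ℝ ℝ (Subtype.val : {k : Fin N // i < k} → Fin N)).prod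
      (Matrix.mulVecLin (Fᵀ * U₀))) (by
        rw [Module.finrank_prod, Module.finrank_fintype_fun_eq_card,
          Module.finrank_fintype_fun_eq_card, Module.finrank_fintype_fun_eq_card,
          Fintype.card_fin, Fintype.card_fin, Fintype.card_subtype]
        have : (Finset.univ.filter fun k => i < k) = Finset.Ioi i := by ext; simp
        rw [this, Fin.card_Ioi]
        have := i.isLt
        omega)
  set v := U₀ *ᵥ b with hv
  have hz : ∀ k, i < k → b k = 0 := fun k hk => by
    exact congrFun (congrArg Prod.fst hfb) ⟨k, hk⟩
  have hMv : Mᵀ *ᵥ v = 0 := by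
    refine hker v ?_
    have : Matrix.mulVecLin (Fᵀ * U₀) b = 0 := congrArg Prod.snd hfb
    rwa [Matrix.mulVecLin_apply, ← Matrix.mulVec_mulVec] at this
  have hUv : U₀ᵀ *ᵥ v = b := by
    rw [hv, Matrix.mulVec_mulVec, h.orthonormal, Matrix.one_mulVec]
  have hnv : euclNorm v = euclNorm b := euclNorm_mulVec_of_transpose_mul_self h.orthonormal b
  have hpos : 0 < euclNorm v := hnv ▸ euclNorm_pos hb
  have h1 : μ i * euclNorm v ^ 2 ≤ euclNorm (Xᵀ *ᵥ v) ^ 2 := by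
    rw [h.euclNorm_sq, hUv, hnv, SubmatrixLocalization.euclNorm_sq, Finset.mul_sum]
    refine Finset.sum_le_sum fun k _ => ?_
    rcases lt_or_ge i k with hk | hk
    · simp [hz k hk]
    · exact mul_le_mul_of_nonneg_right (h.antitone hk) (sq_nonneg _)
  have h2 : euclNorm (Xᵀ *ᵥ v) ≤ ζ * euclNorm v := by
    rw [hX, Matrix.transpose_add, Matrix.add_mulVec, hMv, zero_add]
    have h6 := euclNorm_mulVec_le Zᵀ v
    rw [opNorm_transpose] at h6
    exact h6.trans (mul_le_mul_of_nonneg_right hζ hpos.le)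
  have h3 := pow_le_pow_left₀ (euclNorm_nonneg _) h2 2
  rw [mul_pow] at h3
  exact le_of_mul_le_mul_right (h1.trans h3) (by positivity)

/-- Every matrix `X Xᵀ` has an ordered eigendecomposition. -/
lemma exists_isOrderedEigen (X : Matrix (Fin p) (Fin q) ℝ) :
    ∃ (U₀ : Matrix (Fin p) (Fin p) ℝ) (μ : Fin p → ℝ), IsOrderedEigen (X * Xᵀ) U₀ μ := by
  have hH : (X * Xᵀ).IsHermitian := by
    rw [Matrix.IsHermitian, Matrix.conjTranspose_eq_transpose_of_trivial]; simp
  have hsym := Matrix.isSymmetric_toEuclideanLin_iff.mpr hH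
  have hn : Module.finrank ℝ (EuclideanSpace ℝ (Fin p)) = p := by simp
  set b := hsym.eigenvectorBasis hn with hb
  set U₀ : Matrix (Fin p) (Fin p) ℝ := Matrix.of fun i k => b k i with hU₀
  have horth : U₀ᵀ * U₀ = 1 := by
    ext k k'
    have := orthonormal_iff_ite.1 b.orthonormal k k'
    rw [PiLp.inner_apply] at this
    simp only [Matrix.mul_apply, Matrix.transpose_apply, hU₀, Matrix.of_apply, Matrix.one_apply]
    rw [← this]
    refine Finset.sum_congr rfl fun i _ => ?_
    simp [mul_comm]
  have hcol : ∀ k, (X * Xᵀ) *ᵥ (fun i => U₀ i k) = hsym.eigenvalues hn k • fun i => U₀ i k := by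
    intro k
    have := hsym.apply_eigenvectorBasis hn k
    exact congrArg WithLp.ofLp this
  have hSU : (X * Xᵀ) * U₀ = U₀ * Matrix.diagonal (hsym.eigenvalues hn) := by
    ext i k
    have := congrFun (hcol k) i
    rw [Matrix.mul_diagonal]
    simpa [Matrix.mul_apply, Matrix.mulVec, dotProduct, mul_comm] using this
  have horth' : U₀ * U₀ᵀ = 1 := mul_eq_one_comm.1 horth
  refine ⟨U₀, hsym.eigenvalues hn, horth, fun k => ?_, hsym.eigenvalues_antitone hn, ?_⟩
  · have h1 : euclNorm (Xᵀ *ᵥ (fun i => U₀ i k)) ^ 2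
        = hsym.eigenvalues hn k * ((fun i => U₀ i k) ⬝ᵥ (fun i => U₀ i k)) := by
      rw [euclNorm_sq_eq_dotProduct, Matrix.dotProduct_mulVec, Matrix.vecMul_transpose,
        Matrix.mulVec_mulVec, hcol k, smul_dotProduct, smul_eq_mul]
    have h2 : (fun i => U₀ i k) ⬝ᵥ (fun i => U₀ i k) = 1 := by
      have := congrFun (congrFun horth k) k
      simpa [Matrix.mul_apply, dotProduct] using this
    rw [h2, mul_one] at h1
    rw [← h1]
    positivity
  · rw [← hSU, Matrix.mul_assoc, horth', Matrix.mul_one]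

end Weyl

/-! ### Leave-one-out decoupling of a noise column -/

section LeaveOneOut

variable {p q : ℕ}

/-- The matrix `Z` with column `j` replaced by zero. -/
def dropCol (Z : Matrix (Fin p) (Fin q) ℝ) (j : Fin q) : Matrix (Fin p) (Fin q) ℝ :=
  Matrix.of fun i k => if k = j then 0 else Z i k

lemma dropCol_add_vecMulVec (Z : Matrix (Fin p) (Fin q) ℝ) (j : Fin q) :
    dropCol Z j + Matrix.vecMulVec (fun i => Z i j) (Pi.single j 1) = Z := by
  ext i k
  by_cases h : k = j
  · subst h; simp [dropCol, Matrix.vecMulVec_apply]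
  · simp [dropCol, Matrix.vecMulVec_apply, h]

lemma opNorm_dropCol_le (Z : Matrix (Fin p) (Fin q) ℝ) (j : Fin q) : ‖dropCol Z j‖ ≤ ‖Z‖ := by
  have h : dropCol Z j = Z * Matrix.diagonal (fun k => if k = j then (0 : ℝ) else 1) := by
    ext i k
    rw [Matrix.mul_diagonal]
    by_cases h : k = j <;> simp [dropCol, h]
  rw [h]
  refine (Matrix.l2_opNorm_mul _ _).trans (mul_le_of_le_one_right (norm_nonneg _) ?_)
  refine opNorm_diagonal_le _ zero_le_one fun k => ?_
  split_ifs <;> simp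

lemma add_vecMulVec_mul_transpose (A : Matrix (Fin p) (Fin q) ℝ) (z : Fin p → ℝ) (j : Fin q) :
    (A + Matrix.vecMulVec z (Pi.single j 1)) * (A + Matrix.vecMulVec z (Pi.single j 1))ᵀ
        - A * Aᵀ
      = Matrix.vecMulVec (fun i => A i j) z + Matrix.vecMulVec z (fun i => A i j)
        + Matrix.vecMulVec z z := by
  have h1 : A *ᵥ Pi.single j 1 = fun i => A i j := by
    rw [Matrix.mulVec_single_one]; rfl
  rw [Matrix.transpose_add, Matrix.transpose_vecMulVec, Matrix.add_mul, Matrix.mul_add,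
    Matrix.mul_add, Matrix.mul_vecMulVec, Matrix.vecMulVec_mul, Matrix.vecMulVec_mul_vecMulVec,
    Matrix.vecMul_transpose, h1]
  simp
  abel

/-- Decoupling the noise column `z` from the spectral projection: replacing the spectral
projection of `X` by that of the matrix without the noise in column `j` costs little. -/
lemma euclNorm_proj_mulVec_le {X X' : Matrix (Fin p) (Fin q) ℝ} {P P' : Matrix (Fin p) (Fin p) ℝ}
    {z b : Fin p → ℝ} {j : Fin q} {Θ T g ζ κ : ℝ} (hΘ : 0 < Θ)
    (h : IsSpectralSplit (X * Xᵀ) P Θ T) (h' : IsSpectralSplit (X' * X'ᵀ) P' Θ T)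
    (hX : X = X' + Matrix.vecMulVec z (Pi.single j 1)) (hb : (fun i => X' i j) = b)
    (hg : 0 < g) (hgap : g ^ 2 / 2 ≤ Θ - T) (hzζ : euclNorm z ≤ ζ) (hbκ : euclNorm b ≤ κ)
    (hsmall : 4 * (κ * ζ + ζ ^ 2) ≤ g ^ 2) :
    euclNorm (P *ᵥ z) ≤ 2 * euclNorm (P' *ᵥ z) + 4 * ζ ^ 2 * κ / g ^ 2 := by
  have hD : X * Xᵀ - X' * X'ᵀ
      = Matrix.vecMulVec b z + Matrix.vecMulVec z b + Matrix.vecMulVec z z := by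
    rw [hX, add_vecMulVec_mul_transpose, hb]
  have hvP : ∀ v, v ᵥ* P = P *ᵥ v := fun v => by
    rw [← Matrix.mulVec_transpose, h.symm]
  have h1 := h.norm_compl_mul_le_of_perturb hΘ h'
  rw [hD, Matrix.add_mul, Matrix.add_mul, Matrix.vecMulVec_mul, Matrix.vecMulVec_mul,
    Matrix.vecMulVec_mul, hvP, hvP] at h1
  have hx0 := euclNorm_nonneg (P *ᵥ z)
  have hz0 := euclNorm_nonneg z
  have hb0 := euclNorm_nonneg b
  have hζ0 := hz0.trans hzζ
  have hκ0 := hb0.trans hbκ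
  have hPb0 := euclNorm_nonneg (P *ᵥ b)
  have hPb : euclNorm (P *ᵥ b) ≤ κ :=
    ((euclNorm_mulVec_le P b).trans (mul_le_of_le_one_left hb0 h.norm_le)).trans hbκ
  set x := euclNorm (P *ᵥ z)
  -- The three rank-one terms times `P` become `b (Pz)ᵀ + z (Pb)ᵀ + z (Pz)ᵀ`: two of them contain
  -- the unknown `x = ‖P z‖` itself.
  have h2 : g ^ 2 / 2 * ‖(1 - P') * P‖ ≤ κ * x + ζ * κ + ζ * x := by
    calc g ^ 2 / 2 * ‖(1 - P') * P‖ ≤ (Θ - T) * ‖(1 - P') * P‖ := by gcongr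
      _ ≤ _ := h1
      _ ≤ euclNorm b * x + euclNorm z * euclNorm (P *ᵥ b) + euclNorm z * x :=
        (norm_add₃_le).trans (add_le_add (add_le_add (opNorm_vecMulVec_le _ _)
          (opNorm_vecMulVec_le _ _)) (opNorm_vecMulVec_le _ _))
      _ ≤ _ := by gcongr
  have h3 : x ≤ euclNorm (P' *ᵥ z) + ‖(1 - P') * P‖ * ζ := by
    have e : P *ᵥ z = P *ᵥ (P' *ᵥ z) + ((1 - P') * P)ᵀ *ᵥ z := by
      rw [Matrix.transpose_mul, Matrix.transpose_sub, h'.symm, h.symm, Matrix.transpose_one,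
        Matrix.mul_sub, Matrix.mul_one, Matrix.sub_mulVec, Matrix.mulVec_mulVec]
      abel
    have h4 := euclNorm_add_le (P *ᵥ (P' *ᵥ z)) (((1 - P') * P)ᵀ *ᵥ z)
    rw [← e] at h4
    have h5 := (euclNorm_mulVec_le P (P' *ᵥ z)).trans
      (mul_le_of_le_one_left (euclNorm_nonneg _) h.norm_le)
    have h6 := euclNorm_mulVec_le ((1 - P') * P)ᵀ z
    rw [opNorm_transpose] at h6
    have h7 := mul_le_mul_of_nonneg_left hzζ (norm_nonneg ((1 - P') * P))
    linarith
  have hg2 : 0 < g ^ 2 := by positivity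
  have h8 : g ^ 2 * x ≤ g ^ 2 * euclNorm (P' *ᵥ z) + 2 * (κ * x + ζ * κ + ζ * x) * ζ := by
    nlinarith [mul_le_mul_of_nonneg_right h2 hζ0, mul_le_mul_of_nonneg_left h3 hg2.le]
  -- By `hsmall` the terms `2(κζ + ζ²) x` are at most `g² x / 2` and are absorbed on the left.
  have h9 : g ^ 2 * x ≤ g ^ 2 * (2 * euclNorm (P' *ᵥ z)) + 4 * ζ ^ 2 * κ := by
    nlinarith [mul_le_mul_of_nonneg_right hsmall hx0]
  have h10 : g ^ 2 * (2 * euclNorm (P' *ᵥ z) + 4 * ζ ^ 2 * κ / g ^ 2)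
      = g ^ 2 * (2 * euclNorm (P' *ᵥ z)) + 4 * ζ ^ 2 * κ := by
    field_simp
  exact le_of_mul_le_mul_left (h9.trans_eq h10.symm) hg2

/-- The projection on the leading `r` eigenvectors of `X Xᵀ`, for some choice of them. -/
noncomputable def spectralProj (r : ℕ) (X : Matrix (Fin p) (Fin q) ℝ) : Matrix (Fin p) (Fin p) ℝ :=
  topProj r (exists_isOrderedEigen X).choose

end LeaveOneOut

/-! ### Geometry of the signal: gap, true labels and true centres -/

section Supports

variable {p q r : ℕ}

/-- The matrix with columns `1_{S s}`. -/
def supportMatrix (S : Fin r → Finset (Fin p)) : Matrix (Fin p) (Fin r) ℝ :=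
  Matrix.of fun i s => indicatorVec (S s) i

lemma signal_eq (lam : Fin r → ℝ) (R : Fin r → Finset (Fin p)) (C : Fin r → Finset (Fin q)) :
    signal lam R C = supportMatrix R * Matrix.diagonal lam * (supportMatrix C)ᵀ := by
  ext i j
  rw [Matrix.mul_apply]
  simp only [Matrix.mul_diagonal, signal, supportMatrix, Matrix.sum_apply, Matrix.smul_apply,
    Matrix.vecMulVec_apply, Matrix.transpose_apply, Matrix.of_apply, smul_eq_mul]
  exact Finset.sum_congr rfl fun s _ => by ring

lemma signal_transpose (lam : Fin r → ℝ) (R : Fin r → Finset (Fin p))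
    (C : Fin r → Finset (Fin q)) : (signal lam R C)ᵀ = signal lam C R := by
  rw [signal_eq, signal_eq, Matrix.transpose_mul, Matrix.transpose_mul, Matrix.transpose_transpose,
    Matrix.diagonal_transpose, Matrix.mul_assoc]

lemma supportMatrix_transpose_mul_self {S : Fin r → Finset (Fin p)}
    (hS : ∀ s t, s ≠ t → Disjoint (S s) (S t)) :
    (supportMatrix S)ᵀ * supportMatrix S = Matrix.diagonal fun s => ((S s).card : ℝ) := by
  ext s t
  simp only [supportMatrix, Matrix.mul_apply, Matrix.transpose_apply, Matrix.of_apply, indicatorVec]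
  by_cases h : s = t
  · subst h
    simp
  · rw [Matrix.diagonal_apply_ne _ h]
    refine Finset.sum_eq_zero fun i _ => ?_
    by_cases h1 : i ∈ S s
    · simp [Finset.disjoint_left.1 (hS s t h) h1]
    · simp [h1]

lemma euclNorm_sq_supportMatrix_mulVec {S : Fin r → Finset (Fin p)}
    (hS : ∀ s t, s ≠ t → Disjoint (S s) (S t)) (a : Fin r → ℝ) :
    euclNorm (supportMatrix S *ᵥ a) ^ 2 = ∑ s, ((S s).card : ℝ) * a s ^ 2 := by
  rw [euclNorm_sq_eq_dotProduct, Matrix.dotProduct_mulVec, Matrix.vecMul_mulVec,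
    supportMatrix_transpose_mul_self hS, dotProduct]
  refine Finset.sum_congr rfl fun s _ => ?_
  rw [Matrix.vecMul_diagonal]
  ring

lemma euclNorm_sq_indicatorVec (J : Finset (Fin p)) : euclNorm (indicatorVec J) ^ 2 = J.card := by
  rw [euclNorm_sq]
  simp [indicatorVec]

/-- The quantitative assumptions on the supports and magnitudes: `β` is a lower bound for the norms
of the nonzero columns of the signal, `B * β` an upper bound, and `Q` is a lower bound for the
sizes of all true clusters of columns. -/
structure IsSeparated (lam : Fin r → ℝ) (R : Fin r → Finset (Fin p)) (C : Fin r → Finset (Fin q))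
    (β B Q : ℝ) : Prop where
  disjoint_left : ∀ s t, s ≠ t → Disjoint (R s) (R t)
  disjoint_right : ∀ s t, s ≠ t → Disjoint (C s) (C t)
  pos : 0 < β
  one_le_ratio : 1 ≤ B
  one_le : 1 ≤ Q
  lower : ∀ s, β ≤ lam s * √((R s).card)
  upper : ∀ s, lam s * √((R s).card) ≤ B * β
  card_le : ∀ s, Q ≤ ((C s).card : ℝ)
  background_le : Q ≤ (q : ℝ) - ∑ s, ((C s).card : ℝ)

variable {lam : Fin r → ℝ} {R : Fin r → Finset (Fin p)} {C : Fin r → Finset (Fin q)} {β B Q : ℝ}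

lemma IsSeparated.lower_sq (h : IsSeparated lam R C β B Q) (s : Fin r) :
    β ^ 2 ≤ lam s ^ 2 * (R s).card := by
  have := pow_le_pow_left₀ h.pos.le (h.lower s) 2
  rwa [mul_pow, Real.sq_sqrt (Nat.cast_nonneg _)] at this

lemma IsSeparated.lam_pos (h : IsSeparated lam R C β B Q) (s : Fin r) : 0 < lam s :=
  pos_of_mul_pos_left (h.pos.trans_le (h.lower s)) (Real.sqrt_nonneg _)

lemma IsSeparated.card_pos (h : IsSeparated lam R C β B Q) (s : Fin r) :
    (0 : ℝ) < (R s).card := by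
  have h1 := h.lower s
  rcases Nat.eq_zero_or_pos (R s).card with h0 | h0
  · rw [h0, Nat.cast_zero, Real.sqrt_zero, mul_zero] at h1
    exact absurd h.pos (not_lt.2 h1)
  · exact_mod_cast h0

lemma IsSeparated.supportMatrix_injective (h : IsSeparated lam R C β B Q) (a : Fin r → ℝ)
    (ha : supportMatrix R *ᵥ a = 0) : a = 0 := by
  have h1 := euclNorm_sq_supportMatrix_mulVec h.disjoint_left a
  rw [ha, euclNorm_eq_zero.2 rfl, zero_pow two_ne_zero, eq_comm,
    Finset.sum_eq_zero_iff_of_nonneg fun s _ => by positivity] at h1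
  ext s
  have h2 := h1 s (Finset.mem_univ s)
  simpa [(h.card_pos s).ne'] using h2

/-- The transposed signal sends the orthogonal vectors `1_{R s}` to the orthogonal vectors `lam s |R
s| 1_{C s}`, a stretch of `lam s √|R s| √|C s|`. This gives the singular value gap `β √Q`. -/
lemma IsSeparated.le_euclNorm_signal_transpose_mulVec (h : IsSeparated lam R C β B Q)
    (a : Fin r → ℝ) :
    β * √Q * euclNorm (supportMatrix R *ᵥ a)
      ≤ euclNorm ((signal lam R C)ᵀ *ᵥ (supportMatrix R *ᵥ a)) := by
  have e : (signal lam R C)ᵀ *ᵥ (supportMatrix R *ᵥ a)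
      = supportMatrix C *ᵥ fun s => lam s * ((R s).card * a s) := by
    rw [signal_transpose, signal_eq, Matrix.mulVec_mulVec, Matrix.mul_assoc,
      supportMatrix_transpose_mul_self h.disjoint_left, ← Matrix.mulVec_mulVec,
      ← Matrix.mulVec_mulVec]
    congr 1
    ext s
    rw [Matrix.mulVec_diagonal, Matrix.mulVec_diagonal]
  have hQ : 0 ≤ Q := zero_le_one.trans h.one_le
  rw [← sq_le_sq₀ (mul_nonneg (mul_nonneg h.pos.le (Real.sqrt_nonneg _)) (euclNorm_nonneg _))
    (euclNorm_nonneg _), e, mul_pow, mul_pow, Real.sq_sqrt hQ,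
    euclNorm_sq_supportMatrix_mulVec h.disjoint_left,
    euclNorm_sq_supportMatrix_mulVec h.disjoint_right, Finset.mul_sum]
  refine Finset.sum_le_sum fun s _ => ?_
  calc β ^ 2 * Q * ((R s).card * a s ^ 2)
      ≤ (lam s ^ 2 * (R s).card) * (C s).card * ((R s).card * a s ^ 2) := by
        have := h.lower_sq s
        have := h.card_le s
        gcongr
    _ = (C s).card * (lam s * ((R s).card * a s)) ^ 2 := by ring

lemma signal_transpose_mulVec_eq_zero (v : Fin p → ℝ) (hv : (supportMatrix R)ᵀ *ᵥ v = 0) :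
    (signal lam R C)ᵀ *ᵥ v = 0 := by
  rw [signal_transpose, signal_eq, ← Matrix.mulVec_mulVec, hv, Matrix.mulVec_zero]

lemma IsSeparated.isSpectralSplit {N : ℕ} (h : IsSeparated lam R C β B Q)
    {X Z : Matrix (Fin p) (Fin q) ℝ} {U₀ : Matrix (Fin p) (Fin N) ℝ} {μ : Fin N → ℝ}
    (hU : IsOrderedEigen (X * Xᵀ) U₀ μ) (hX : X = signal lam R C + Z) {ζ : ℝ} (hZ : ‖Z‖ ≤ ζ)
    (hζ : ζ < β * √Q) :
    IsSpectralSplit (X * Xᵀ) (topProj r U₀) ((β * √Q - ζ) ^ 2) (ζ ^ 2) :=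
  hU.isSpectralSplit (pow_pos (sub_pos.2 hζ) 2) (sq_nonneg _)
    (hU.le_of_lt hX h.supportMatrix_injective h.le_euclNorm_signal_transpose_mulVec hZ hζ.le)
    (hU.le_of_ge hX signal_transpose_mulVec_eq_zero hZ)

lemma IsSeparated.isSpectralSplit_spectralProj (h : IsSeparated lam R C β B Q)
    {X Z : Matrix (Fin p) (Fin q) ℝ} (hX : X = signal lam R C + Z) {ζ : ℝ} (hZ : ‖Z‖ ≤ ζ)
    (hζ : ζ < β * √Q) :
    IsSpectralSplit (X * Xᵀ) (spectralProj r X) ((β * √Q - ζ) ^ 2) (ζ ^ 2) :=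
  h.isSpectralSplit (exists_isOrderedEigen X).choose_spec.choose_spec hX hZ hζ

/-- The true label of column `j`: the index of the support that contains it, or `none` for the
background. -/
noncomputable def trueLabel (C : Fin r → Finset (Fin q)) (j : Fin q) : Option (Fin r) :=
  open Classical in if h : ∃ s, j ∈ C s then some h.choose else none

/-- The true centres: the distinct columns of the signal. -/
def trueCenter (lam : Fin r → ℝ) (R : Fin r → Finset (Fin p)) : Option (Fin r) → Fin p → ℝ
  | none => 0
  | some s => lam s • indicatorVec (R s)

lemma trueLabel_eq_some_iff (hC : ∀ s t, s ≠ t → Disjoint (C s) (C t)) (j : Fin q) (s : Fin r) :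
    trueLabel C j = some s ↔ j ∈ C s := by
  unfold trueLabel
  constructor
  · intro h
    split_ifs at h with hj
    rw [← Option.some.inj h]
    exact hj.choose_spec
  · intro hs
    have hj : ∃ s, j ∈ C s := ⟨s, hs⟩
    rw [dif_pos hj]
    by_contra hne
    exact Finset.disjoint_left.1 (hC _ s fun h => hne (congrArg some h)) hj.choose_spec hs

lemma trueLabel_eq_none_iff (j : Fin q) : trueLabel C j = none ↔ ∀ s, j ∉ C s := by
  unfold trueLabel
  split_ifs with h
  · simpa using h
  · simpa using h

lemma signal_col (hC : ∀ s t, s ≠ t → Disjoint (C s) (C t)) (j : Fin q) :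
    (fun i => signal lam R C i j) = trueCenter lam R (trueLabel C j) := by
  ext i
  simp only [signal, Matrix.sum_apply, Matrix.smul_apply, Matrix.vecMulVec_apply, smul_eq_mul]
  rcases h : trueLabel C j with _ | s
  · rw [trueLabel_eq_none_iff] at h
    simp [trueCenter, indicatorVec, h]
  · rw [trueLabel_eq_some_iff hC] at h
    rw [Finset.sum_eq_single s]
    · simp [trueCenter, indicatorVec, h]
    · intro t _ hts
      have : j ∉ C t := fun ht => Finset.disjoint_left.1 (hC t s hts) ht h
      simp [indicatorVec, this]
    · simp

lemma IsSeparated.euclNorm_trueCenter_some (h : IsSeparated lam R C β B Q) (s : Fin r) :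
    euclNorm (trueCenter lam R (some s)) = lam s * √((R s).card) := by
  rw [trueCenter, euclNorm_smul, abs_of_pos (h.lam_pos s), ← euclNorm_sq_indicatorVec,
    Real.sqrt_sq (euclNorm_nonneg _)]

lemma IsSeparated.le_euclNorm_sub_trueCenter (h : IsSeparated lam R C β B Q)
    (s s' : Option (Fin r)) (hne : s ≠ s') :
    β ≤ euclNorm (trueCenter lam R s - trueCenter lam R s') := by
  have key : ∀ s s', some s ≠ s' →
      β ≤ euclNorm (trueCenter lam R (some s) - trueCenter lam R s') := by
    intro s s' hne
    rcases s' with _ | s'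
    · simpa [trueCenter] using (h.lower s).trans_eq (h.euclNorm_trueCenter_some s).symm
    · have hss : s ≠ s' := fun e => hne (congrArg some e)
      rw [← sq_le_sq₀ h.pos.le (euclNorm_nonneg _)]
      refine (h.lower_sq s).trans ?_
      rw [← Real.sq_sqrt (Nat.cast_nonneg (R s).card), ← mul_pow, ← h.euclNorm_trueCenter_some s,
        euclNorm_sq, euclNorm_sq]
      -- Where centre `s` is nonzero, disjointness makes centre `s'` vanish, so subtracting it only
      -- adds energy.
      refine Finset.sum_le_sum fun i _ => ?_
      by_cases hi : i ∈ R s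
      · have : i ∉ R s' := Finset.disjoint_left.1 (h.disjoint_left s s' hss) hi
        simp [trueCenter, indicatorVec, this]
      · have : trueCenter lam R (some s) i = 0 := by simp [trueCenter, indicatorVec, hi]
        rw [this, zero_pow two_ne_zero]
        exact sq_nonneg _
  rcases s with _ | s
  · rcases s' with _ | s'
    · exact absurd rfl hne
    · have := key s' none (by simp)
      have e : euclNorm (trueCenter lam R none - trueCenter lam R (some s'))
          = euclNorm (trueCenter lam R (some s') - trueCenter lam R none) :=
        norm_sub_rev (WithLp.toLp 2 _) (WithLp.toLp 2 _)
      rwa [e]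
  · exact key s s' hne

lemma IsSeparated.le_card_trueLabel_eq (h : IsSeparated lam R C β B Q) (s : Option (Fin r)) :
    Q ≤ ((Finset.univ.filter fun j => trueLabel C j = s).card : ℝ) := by
  rcases s with _ | s
  · have e : (Finset.univ.filter fun j => trueLabel C j = none) = (Finset.univ.biUnion C)ᶜ := by
      ext j; simp [trueLabel_eq_none_iff]
    rw [e, Finset.card_compl, Nat.cast_sub (Finset.card_le_univ _), Finset.card_biUnion
      (fun s _ t _ hst => h.disjoint_right s t hst)]
    simpa using h.background_le
  · have e : (Finset.univ.filter fun j => trueLabel C j = some s) = C s := by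
      ext j; simp [trueLabel_eq_some_iff h.disjoint_right]
    rw [e]
    exact h.card_le s

end Supports
-- Deterministic recovery under small noise
section Deterministic

variable {p q r N : ℕ} {lam : Fin r → ℝ} {R : Fin r → Finset (Fin p)} {C : Fin r → Finset (Fin q)}
  {β B Q : ℝ} {Z : Matrix (Fin p) (Fin q) ℝ}

/-- The noise is small enough for exact recovery of the columns: its operator norm is small, and so
is each of its columns after projection on the leave-one-out singular space. -/
structure IsSmallNoise (lam : Fin r → ℝ) (R : Fin r → Finset (Fin p)) (C : Fin r → Finset (Fin q))
    (β B Q : ℝ) (Z : Matrix (Fin p) (Fin q) ℝ) : Prop where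
  norm_le : ‖Z‖ ≤ β * √Q / (100 * B)
  proj_le : ∀ j, euclNorm (spectralProj r (signal lam R C + dropCol Z j) *ᵥ fun i => Z i j)
    ≤ β / (100 * B)

lemma opNorm_compl_mul_sq_le {X : Matrix (Fin p) (Fin q) ℝ} {P : Matrix (Fin p) (Fin p) ℝ}
    {Θ T : ℝ} (h : IsSpectralSplit (X * Xᵀ) P Θ T) : ‖(1 - P) * X‖ ^ 2 ≤ T := by
  have e : ((1 - P) * X) * ((1 - P) * X)ᵀ = (1 - P) * (X * Xᵀ) * (1 - P) := by
    rw [Matrix.transpose_mul, Matrix.transpose_sub, h.symm, Matrix.transpose_one]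
    simp only [Matrix.mul_assoc]
  rw [← opNorm_mul_transpose_self, e, h.compl_mul_compl]
  exact h.norm_compl_mul_le

/-- `(1 - P) M = (1 - P) X - (1 - P) Z`, where the first term is governed by the small singular
values of `X` and the second by `Z`. -/
lemma opNorm_compl_mul_le {X M : Matrix (Fin p) (Fin q) ℝ} {P : Matrix (Fin p) (Fin p) ℝ}
    {Θ ζ : ℝ} (h : IsSpectralSplit (X * Xᵀ) P Θ (ζ ^ 2)) (hX : X = M + Z) (hZ : ‖Z‖ ≤ ζ) :
    ‖(1 - P) * M‖ ≤ 2 * ζ := by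
  have hζ := (norm_nonneg _).trans hZ
  have e : (1 - P) * M = (1 - P) * X - (1 - P) * Z := by rw [hX, Matrix.mul_add]; abel
  have h1 : ‖(1 - P) * X‖ ≤ ζ :=
    (sq_le_sq₀ (norm_nonneg _) hζ).1 (opNorm_compl_mul_sq_le h)
  have h2 : ‖(1 - P) * Z‖ ≤ ζ :=
    ((Matrix.l2_opNorm_mul _ _).trans
      (mul_le_of_le_one_left (norm_nonneg _) h.norm_compl_le)).trans hZ
  rw [e]
  linarith [_root_.norm_sub_le ((1 - P) * X) ((1 - P) * Z)]

lemma mulVec_indicatorVec (A : Matrix (Fin p) (Fin q) ℝ) (J : Finset (Fin q)) :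
    A *ᵥ indicatorVec J = ∑ j ∈ J, fun i => A i j := by
  ext i
  simp [Matrix.mulVec, dotProduct, indicatorVec]

lemma euclNorm_sum_col_le (A : Matrix (Fin p) (Fin q) ℝ) (J : Finset (Fin q)) :
    euclNorm (∑ j ∈ J, fun i => A i j) ^ 2 ≤ ‖A‖ ^ 2 * J.card := by
  rw [← mulVec_indicatorVec, ← euclNorm_sq_indicatorVec, ← mul_pow]
  exact pow_le_pow_left₀ (euclNorm_nonneg _) (euclNorm_mulVec_le _ _) 2

lemma euclNorm_col_le (A : Matrix (Fin p) (Fin q) ℝ) (j : Fin q) :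
    euclNorm (fun i => A i j) ≤ ‖A‖ := by
  have h := euclNorm_sum_col_le A {j}
  rw [Finset.sum_singleton, Finset.card_singleton, Nat.cast_one, mul_one] at h
  exact (sq_le_sq₀ (euclNorm_nonneg _) (norm_nonneg _)).1 h

/-- A nonzero column of the signal occurs `|C s| ≥ Q` times. Applying `A M` to `1_{C s}`, of norm
`√|C s|`, yields `|C s|` copies of the same vector, so a single column gains a factor `√Q` over the
operator norm. -/
lemma IsSeparated.euclNorm_compl_signal_col_le (h : IsSeparated lam R C β B Q)
    {A : Matrix (Fin p) (Fin p) ℝ} {K : ℝ} (hA : ‖A * signal lam R C‖ ≤ K) (j : Fin q) :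
    √Q * euclNorm (A *ᵥ fun i => signal lam R C i j) ≤ K := by
  have hK := (norm_nonneg _).trans hA
  rcases hj : trueLabel C j with _ | s
  · rw [signal_col h.disjoint_right, hj, trueCenter, Matrix.mulVec_zero, euclNorm_eq_zero.2 rfl]
    simpa using hK
  · have h1 := euclNorm_sum_col_le (A * signal lam R C) (C s)
    have h2 : ∑ k ∈ C s, (fun i => (A * signal lam R C) i k)
        = ((C s).card : ℝ) • (A *ᵥ fun i => signal lam R C i j) := by
      rw [Nat.cast_smul_eq_nsmul, ← Finset.sum_const]
      refine Finset.sum_congr rfl fun k hk => ?_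
      rw [← trueLabel_eq_some_iff h.disjoint_right] at hk
      have h3 : (fun i => signal lam R C i j) = fun i => signal lam R C i k := by
        rw [signal_col h.disjoint_right, signal_col h.disjoint_right, hj, hk]
      rw [h3]
      rfl
    rw [h2, euclNorm_smul, Nat.abs_cast, mul_pow] at h1
    have hQ : 0 < Q := zero_lt_one.trans_le h.one_le
    have hc : Q ≤ (C s).card := h.card_le s
    rw [← sq_le_sq₀ (mul_nonneg (Real.sqrt_nonneg _) (euclNorm_nonneg _)) hK, mul_pow,
      Real.sq_sqrt hQ.le]
    have h4 : ((C s).card : ℝ) * (Q * euclNorm (A *ᵥ fun i => signal lam R C i j) ^ 2)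
        ≤ (C s).card * K ^ 2 := by
      calc _ ≤ ((C s).card : ℝ) * ((C s).card * euclNorm (A *ᵥ fun i => signal lam R C i j) ^ 2) :=
            by gcongr
        _ = (C s).card ^ 2 * euclNorm (A *ᵥ fun i => signal lam R C i j) ^ 2 := by ring
        _ ≤ _ := h1
        _ ≤ K ^ 2 * (C s).card := by gcongr
        _ = _ := by ring
    exact le_of_mul_le_mul_left h4 (hQ.trans_le hc)

/-- The deterministic part: if the noise is small, the projected columns are clustered exactly. -/
theorem IsSeparated.identifies (h : IsSeparated lam R C β B Q)
    (hZ : IsSmallNoise lam R C β B Q Z) {U₀ : Matrix (Fin p) (Fin N) ℝ} {μ : Fin N → ℝ}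
    (hU : IsOrderedEigen ((signal lam R C + Z) * (signal lam R C + Z)ᵀ) U₀ μ)
    {l : Fin q → Fin (r + 1)} {c : Fin (r + 1) → EuclideanSpace ℝ (Fin p)}
    (hl : IsKMeans (fun j => WithLp.toLp 2 (topProj r U₀ *ᵥ fun i => (signal lam R C + Z) i j))
      l c) : Identifies l c C := by
  set M := signal lam R C with hM
  set P := topProj r U₀ with hP
  set ζ := β * √Q / (100 * B) with hζ
  have hβ := h.pos
  have hB := h.one_le_ratio
  have hQ : 0 < Q := zero_lt_one.trans_le h.one_le
  have hsQ : 1 ≤ √Q := Real.one_le_sqrt.2 h.one_le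
  have hg : 0 < β * √Q := by positivity
  have hζ0 : 0 ≤ ζ := by positivity
  have hζB : 100 * (B * ζ) = β * √Q := by rw [hζ]; field_simp
  have hζg : 100 * ζ ≤ β * √Q := by nlinarith
  have hζg' : ζ < β * √Q := by linarith
  have hβg : β ≤ β * √Q := le_mul_of_one_le_right hβ.le hsQ
  have hBβζ : B * β * ζ ≤ (β * √Q) ^ 2 / 100 := by
    have : B * β * ζ = β * (β * √Q) / 100 := by rw [← hζB]; ring
    rw [this]
    nlinarith
  have hζ2 : ζ ^ 2 ≤ (β * √Q) ^ 2 / 10000 := by nlinarith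
  have hsplit := h.isSpectralSplit hU rfl hZ.norm_le hζg'
  have hPM : ‖(1 - P) * M‖ ≤ 2 * ζ := opNorm_compl_mul_le hsplit rfl hZ.norm_le
  set E := P * Z - (1 - P) * M with hE
  have hEnorm : ‖E‖ ≤ 3 * ζ := by
    have h1 : ‖P * Z‖ ≤ ζ := ((Matrix.l2_opNorm_mul _ _).trans
      (mul_le_of_le_one_left (norm_nonneg _) hsplit.norm_le)).trans hZ.norm_le
    linarith [_root_.norm_sub_le (P * Z) ((1 - P) * M)]
  have hEM : P * (M + Z) = M + E := by
    rw [hE, Matrix.mul_add, Matrix.sub_mul, Matrix.one_mul]; abel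
  have hdev : ∀ j, (P *ᵥ fun i => (M + Z) i j) - trueCenter lam R (trueLabel C j)
      = fun i => E i j := by
    intro j
    rw [← signal_col h.disjoint_right (R := R) (lam := lam)]
    have : (P *ᵥ fun i => (M + Z) i j) = fun i => (P * (M + Z)) i j := rfl
    rw [this, hEM]
    ext i
    simp [hM]
  -- each projected column is close to its true centre
  have hcol : ∀ j, euclNorm (fun i => E i j) ≤ β / 16 := by
    intro j
    have e : (fun i => E i j) = (P *ᵥ fun i => Z i j) - (1 - P) *ᵥ fun i => M i j := rfl
    have h1 := euclNorm_sub_le (P *ᵥ fun i => Z i j) ((1 - P) *ᵥ fun i => M i j)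
    have h2 : euclNorm ((1 - P) *ᵥ fun i => M i j) ≤ β / 50 := by
      have := h.euclNorm_compl_signal_col_le hPM j
      have h3 : √Q * euclNorm ((1 - P) *ᵥ fun i => M i j) ≤ √Q * (β / 50) := by linarith
      exact le_of_mul_le_mul_left h3 (by positivity)
    have hb : (fun i => (M + dropCol Z j) i j) = fun i => M i j := by
      ext i; simp [dropCol]
    have hbκ : euclNorm (fun i => M i j) ≤ B * β := by
      rw [hM, signal_col h.disjoint_right]
      rcases trueLabel C j with _ | s
      · rw [trueCenter, euclNorm_eq_zero.2 rfl]
        positivity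
      · rw [h.euclNorm_trueCenter_some]
        exact h.upper s
    have hsplit' := h.isSpectralSplit_spectralProj (X := M + dropCol Z j) rfl
      ((opNorm_dropCol_le Z j).trans hZ.norm_le) hζg'
    have h4 := euclNorm_proj_mulVec_le (z := fun i => Z i j) (j := j) (g := β * √Q) (ζ := ζ)
      (κ := B * β) (pow_pos (sub_pos.2 hζg') 2) hsplit hsplit'
      (by rw [add_assoc, dropCol_add_vecMulVec]) hb hg (by nlinarith)
      ((euclNorm_col_le Z j).trans hZ.norm_le) hbκ (by linarith [sq_nonneg (β * √Q)])
    have h5 : 4 * ζ ^ 2 * (B * β) / (β * √Q) ^ 2 ≤ β / 2500 := by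
      rw [div_le_iff₀ (by positivity)]
      have h6 : ζ * (B * β * ζ) = ζ * (β * (β * √Q)) / 100 := by
        rw [← hζB]; ring
      nlinarith [mul_le_mul_of_nonneg_right hζg (mul_nonneg hβ.le hg.le)]
    have h6 := hZ.proj_le j
    have h7 : β / (100 * B) ≤ β / 100 := by
      gcongr
      linarith
    rw [e]
    -- The error budget is `2β/100 + β/2500` for the noise and `β/50` for the signal, below `β/16`.
    linarith
  have hxlp : ∀ j, (WithLp.toLp 2 (P *ᵥ fun i => (M + Z) i j) : EuclideanSpace ℝ (Fin p))
      - WithLp.toLp 2 (trueCenter lam R (trueLabel C j)) = WithLp.toLp 2 (fun i => E i j) :=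
    fun j => by rw [← WithLp.toLp_sub, hdev]
  obtain ⟨e, he, hce⟩ := hl.exists_equiv (trueLabel C)
    (fun s => WithLp.toLp 2 (trueCenter lam R s)) (Δ := β) (η := 3 * ζ) (Q := Q)
    (by simp) hβ hQ
    (fun s s' hne => h.le_euclNorm_sub_trueCenter s s' hne)
    (fun j => by rw [hxlp]; exact hcol j)
    (fun J => by
      rw [Finset.sum_congr rfl fun j _ => hxlp j, ← WithLp.toLp_sum]
      refine (euclNorm_sum_col_le E J).trans ?_
      gcongr)
    h.le_card_trueLabel_eq
    (by
      -- The required inequality reads `18 ζ² < Q β² / 32`, and `ζ² ≤ Q β² / 10⁴`.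
      have : (100 * ζ) ^ 2 ≤ (β * √Q) ^ 2 := pow_le_pow_left₀ (by positivity) hζg 2
      rw [mul_pow β, Real.sq_sqrt hQ.le] at this
      have : 0 < β ^ 2 * Q := by positivity
      nlinarith)
  refine ⟨⟨fun s => e (some s), fun s s' hs => Option.some.inj (e.injective hs)⟩,
    fun s j => ?_, fun b hb s => ?_⟩
  · rw [he, ← trueLabel_eq_some_iff h.disjoint_right]
    exact e.apply_eq_iff_eq
  · obtain ⟨o, rfl⟩ := e.surjective b
    rcases o with _ | s'
    -- The background centre lies within `β/4` of zero, while the others have norm at least `3β/4`.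
    · have h0 := hce none
      have h1 := hce (some s)
      have h2 : β ≤ ‖(WithLp.toLp 2 (trueCenter lam R (some s)) : EuclideanSpace ℝ (Fin p))‖ :=
        (h.lower s).trans_eq (h.euclNorm_trueCenter_some s).symm
      have h3 : (WithLp.toLp 2 (trueCenter lam R none) : EuclideanSpace ℝ (Fin p)) = 0 := rfl
      rw [h3, sub_zero] at h0
      have h4 := norm_sub_norm_le
        (WithLp.toLp 2 (trueCenter lam R (some s)) : EuclideanSpace ℝ (Fin p)) (c (e (some s)))
      rw [norm_sub_rev] at h4
      change ‖c (e none)‖ < ‖c (e (some s))‖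
      linarith
    · exact absurd ⟨s', rfl⟩ hb

end Deterministic

/-! ### From singular value decompositions to spectral projections -/

section SingularVectors

variable {m n r : ℕ} {X : Matrix (Fin m) (Fin n) ℝ}

lemma IsSVD.transpose {U : Matrix (Fin m) (Fin (min m n)) ℝ} {s : Fin (min m n) → ℝ}
    {V : Matrix (Fin n) (Fin (min m n)) ℝ} (h : IsSVD X U s V) :
    Xᵀ = V * Matrix.diagonal s * Uᵀ := by
  rw [h.eq, Matrix.transpose_mul, Matrix.transpose_mul, Matrix.transpose_transpose,
    Matrix.diagonal_transpose, Matrix.mul_assoc]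

lemma isOrderedEigen_of_eq {p q N : ℕ} {Y : Matrix (Fin p) (Fin q) ℝ}
    {U : Matrix (Fin p) (Fin N) ℝ} {s : Fin N → ℝ} {V : Matrix (Fin q) (Fin N) ℝ}
    (hU : Uᵀ * U = 1) (hV : Vᵀ * V = 1) (h0 : ∀ k, 0 ≤ s k) (hs : Antitone s)
    (hY : Y = U * Matrix.diagonal s * Vᵀ) : IsOrderedEigen (Y * Yᵀ) U fun k => s k ^ 2 := by
  refine ⟨hU, fun k => sq_nonneg _, fun k k' hk => pow_le_pow_left₀ (h0 _) (hs hk) 2, ?_⟩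
  rw [hY, Matrix.transpose_mul, Matrix.transpose_mul, Matrix.transpose_transpose,
    Matrix.diagonal_transpose]
  calc _ = U * Matrix.diagonal s * (Vᵀ * V) * Matrix.diagonal s * Uᵀ := by
        simp only [Matrix.mul_assoc]
    _ = _ := by
        rw [hV, Matrix.mul_one, Matrix.mul_assoc U, Matrix.diagonal_mul_diagonal]
        simp only [sq]

lemma submatrix_castLE_mul_transpose {p N : ℕ} (h : r ≤ N) (U₀ : Matrix (Fin p) (Fin N) ℝ) :
    U₀.submatrix id (Fin.castLE h) * (U₀.submatrix id (Fin.castLE h))ᵀ = topProj r U₀ := by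
  ext i j
  rw [topProj, Matrix.mul_apply, Matrix.mul_apply]
  simp only [Matrix.mul_diagonal, Matrix.submatrix_apply, Matrix.transpose_apply, id, mul_ite,
    mul_one, mul_zero, ite_mul, zero_mul]
  rw [← Finset.sum_filter]
  refine Finset.sum_bij (fun k _ => Fin.castLE h k) (fun k _ => by simp)
    (fun k _ k' _ hk => Fin.castLE_injective h hk) (fun k hk => ?_) (fun k _ => rfl)
  rw [Finset.mem_filter] at hk
  exact ⟨⟨k, hk.2⟩, Finset.mem_univ _, rfl⟩

lemma submatrix_castLE_transpose_mul {p N : ℕ} (h : r ≤ N) {U₀ : Matrix (Fin p) (Fin N) ℝ}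
    (hU : U₀ᵀ * U₀ = 1) :
    (U₀.submatrix id (Fin.castLE h))ᵀ * U₀.submatrix id (Fin.castLE h) = 1 := by
  ext k k'
  have := congrFun (congrFun hU (Fin.castLE h k)) (Fin.castLE h k')
  rw [Matrix.mul_apply] at this ⊢
  simp only [Matrix.transpose_apply, Matrix.submatrix_apply, id] at this ⊢
  rw [this, Matrix.one_apply, Matrix.one_apply]
  simp [Fin.ext_iff]

/-- The chosen singular vectors are orthonormal, so the inverse Gram factor is the identity. -/
lemma projectedColumns_eq {p q N : ℕ} (h : r ≤ N) {U₀ : Matrix (Fin p) (Fin N) ℝ}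
    (hU : U₀ᵀ * U₀ = 1) (Y : Matrix (Fin p) (Fin q) ℝ) :
    projectedColumns (U₀.submatrix id (Fin.castLE h)) Y
      = fun j => WithLp.toLp 2 (topProj r U₀ *ᵥ fun i => Y i j) := by
  funext j
  rw [projectedColumns, submatrix_castLE_transpose_mul h hU, inv_one, Matrix.mul_one,
    submatrix_castLE_mul_transpose]

/-- The spectral algorithm succeeds as soon as the noise is small for the columns and for the
rows. -/
theorem spectralSucceeds_of_isSmallNoise {lam : Fin r → ℝ} {R : Fin r → Finset (Fin m)}
    {C : Fin r → Finset (Fin n)} {β B Q β' B' Q' : ℝ} {Z : Matrix (Fin m) (Fin n) ℝ}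
    (h : IsSeparated lam R C β B Q) (hZ : IsSmallNoise lam R C β B Q Z)
    (h' : IsSeparated lam C R β' B' Q') (hZ' : IsSmallNoise lam C R β' B' Q' Zᵀ) :
    SpectralSucceeds (signal lam R C + Z) R C := by
  rintro U V ⟨hr, U₀, s, V₀, hsvd, rfl, rfl⟩
  refine ⟨fun l c hl => ?_, fun l c hl => ?_⟩
  · rw [projectedColumns_eq hr hsvd.left_orthonormal] at hl
    exact h.identifies hZ (isOrderedEigen_of_eq hsvd.left_orthonormal hsvd.right_orthonormal
      hsvd.nonneg hsvd.antitone hsvd.eq) hl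
  · rw [projectedColumns_eq hr hsvd.right_orthonormal] at hl
    have e : (signal lam R C + Z)ᵀ = signal lam C R + Zᵀ := by
      rw [Matrix.transpose_add, signal_transpose]
    have hS := isOrderedEigen_of_eq hsvd.right_orthonormal hsvd.left_orthonormal
      hsvd.nonneg hsvd.antitone hsvd.transpose
    rw [e] at hS hl
    exact h'.identifies hZ' hS hl

end SingularVectors
-- Sub-Gaussian tail bounds by averaging over balls
section Averaging

/-- A tail bound by averaging: if every `ω ∈ A` makes `f ω` large on a subset of `S` of measure at
least `v`, and the exponential moments of `f · τ` are bounded for `τ ∈ S`, then `A` is small. -/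
lemma measure_mul_le_of_averaging {Ω T : Type*} [MeasurableSpace Ω] [MeasurableSpace T]
    (P : Measure Ω) [SFinite P] (ν : Measure T) [SFinite ν] {f : Ω → T → ℝ}
    (hf : Measurable (Function.uncurry f)) {A : Set Ω} {S : Set T} (hS : MeasurableSet S)
    {L : ℝ} {v K : ℝ≥0∞}
    (hA : ∀ ω ∈ A, ∃ D ⊆ S, MeasurableSet D ∧ v ≤ ν D ∧ ∀ τ ∈ D, L ≤ f ω τ)
    (hK : ∀ τ ∈ S, ∫⁻ ω, ENNReal.ofReal (Real.exp (f ω τ)) ∂P ≤ K) :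
    ENNReal.ofReal (Real.exp L) * v * P A ≤ K * ν S := by
  have hmeas : Measurable (Function.uncurry fun ω τ => ENNReal.ofReal (Real.exp (f ω τ))) :=
    ENNReal.measurable_ofReal.comp (Real.measurable_exp.comp hf)
  have hswap : ∫⁻ ω, ∫⁻ τ in S, ENNReal.ofReal (Real.exp (f ω τ)) ∂ν ∂P ≤ K * ν S := by
    rw [lintegral_lintegral_swap hmeas.aemeasurable, ← setLIntegral_const]
    exact setLIntegral_mono' hS hK
  refine le_trans ?_ hswap
  refine le_trans ?_ (mul_meas_ge_le_lintegral (hmeas.lintegral_prod_right' (ν := ν.restrict S))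
    (ENNReal.ofReal (Real.exp L) * v))
  gcongr
  intro ω hω
  obtain ⟨D, hDS, hD, hv, hL⟩ := hA ω hω
  calc ENNReal.ofReal (Real.exp L) * v ≤ ENNReal.ofReal (Real.exp L) * ν D := by gcongr
    _ = ∫⁻ _ in D, ENNReal.ofReal (Real.exp L) ∂ν := (setLIntegral_const _ _).symm
    _ ≤ ∫⁻ τ in D, ENNReal.ofReal (Real.exp (f ω τ)) ∂ν :=
      setLIntegral_mono' hD fun τ hτ => ENNReal.ofReal_le_ofReal (Real.exp_le_exp.2 (hL τ hτ))
    _ ≤ _ := lintegral_mono_set hDS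

lemma volume_ball_five_quarters (k : ℕ) (u : EuclideanSpace ℝ (Fin k)) :
    volume (Metric.ball (0 : EuclideanSpace ℝ (Fin k)) (5 / 4))
      = ENNReal.ofReal (5 ^ k) * volume (Metric.ball u (1 / 4)) := by
  rw [Measure.addHaar_ball_of_pos volume u (by norm_num : (0 : ℝ) < 1 / 4),
    Measure.addHaar_ball_of_pos volume 0 (by norm_num : (0 : ℝ) < 5 / 4), finrank_euclideanSpace,
    Fintype.card_fin, ← mul_assoc, ← ENNReal.ofReal_mul (by positivity), ← mul_pow]
  norm_num

lemma five_pow_le_exp (k : ℕ) : (5 : ℝ) ^ k ≤ Real.exp (2 * k) := by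
  have h1 := Real.exp_one_gt_d9
  have h2 : (5 : ℝ) ≤ Real.exp 2 := by
    have : Real.exp 2 = Real.exp 1 * Real.exp 1 := by rw [← Real.exp_add]; norm_num
    rw [this]
    nlinarith
  calc (5 : ℝ) ^ k ≤ Real.exp 2 ^ k := by gcongr
    _ = Real.exp (2 * k) := by rw [← Real.exp_nat_mul, mul_comm]

lemma ball_subset_ball_five_quarters {E : Type*} [SeminormedAddCommGroup E] {u : E}
    (hu : ‖u‖ = 1) : Metric.ball u (1 / 4) ⊆ Metric.ball 0 (5 / 4) := by
  refine Metric.ball_subset_ball' ?_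
  rw [dist_zero_right, hu]
  norm_num

/-- Tail bound for the norm of a sub-Gaussian random vector of dimension `r`. -/
lemma measure_lt_euclNorm_le {Ω : Type*} [MeasurableSpace Ω] (P : Measure Ω)
    [IsProbabilityMeasure P] {r : ℕ} {A : Ω → Fin r → ℝ} (hA : ∀ i, Measurable fun ω => A ω i)
    {c : ℝ} (hc : 0 < c)
    (hmgf : ∀ y, ∫⁻ ω, ENNReal.ofReal (Real.exp (y ⬝ᵥ A ω)) ∂P
      ≤ ENNReal.ofReal (Real.exp (c / 2 * euclNorm y ^ 2)))
    {x : ℝ} (hx : 0 ≤ x) :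
    P {ω | 4 * √c * (√r + √x) < euclNorm (A ω)} ≤ ENNReal.ofReal (Real.exp (-(2 * x))) := by
  set h := √r + √x with hh
  have hh0 : 0 ≤ h := by positivity
  have hh2 : r + x ≤ h ^ 2 := by
    have h1 := Real.sq_sqrt (Nat.cast_nonneg (α := ℝ) r)
    have h2 := Real.sq_sqrt hx
    have := mul_nonneg (Real.sqrt_nonneg (r : ℝ)) (Real.sqrt_nonneg x)
    rw [hh]
    nlinarith
  have hsc : 0 < √c := Real.sqrt_pos.2 hc
  have hsc2 : √c ^ 2 = c := Real.sq_sqrt hc.le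
  set V : ℝ≥0∞ := volume (Metric.ball (0 : EuclideanSpace ℝ (Fin r)) (1 / 4)) with hV
  have hball : ∀ u : EuclideanSpace ℝ (Fin r), volume (Metric.ball u (1 / 4)) = V := fun u => by
    rw [hV, Measure.addHaar_ball_center]
  have hV0 : V ≠ 0 := (Metric.measure_ball_pos volume _ (by norm_num)).ne'
  have hVt : V ≠ ∞ := measure_ball_lt_top.ne
  -- With `u` the direction of `A ω`, every `y` within `1/4` of `u` has `y · A ≥ (3/4)‖A‖ > 3√c h`,
  -- whence `L = 3h²`. As `‖y‖ ≤ 5/4`, the moment exponent is `(25/16) h²/2`. The volume ratio `5^r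
  -- ≤ e^{2r}` replaces the size of a net, and `-3h² + (25/32)h² + 2r ≤ -2x` because `r + x ≤ h²`.
  have hmain := measure_mul_le_of_averaging P (volume : Measure (EuclideanSpace ℝ (Fin r)))
    (f := fun ω y => h / √c * (WithLp.ofLp y ⬝ᵥ A ω))
    (A := {ω | 4 * √c * h < euclNorm (A ω)}) (S := Metric.ball 0 (5 / 4)) (L := 3 * h ^ 2)
    (v := V) (K := ENNReal.ofReal (Real.exp (25 / 32 * h ^ 2))) (by
      unfold Function.uncurry dotProduct
      refine Measurable.const_mul (Finset.measurable_sum _ fun i _ => Measurable.mul ?_ ?_) _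
      · exact (by fun_prop : Continuous fun y : EuclideanSpace ℝ (Fin r) => y i).measurable.comp
          measurable_snd
      · exact (hA i).comp measurable_fst)
    Metric.isOpen_ball.measurableSet ?_ ?_
  · rw [volume_ball_five_quarters r 0, hball, ← mul_assoc, mul_right_comm] at hmain
    have h1 := (ENNReal.mul_le_mul_iff_left hV0 hVt).1 hmain
    rw [← ENNReal.ofReal_mul (Real.exp_pos _).le] at h1
    have e1 : (1 : ℝ≥0∞) = ENNReal.ofReal (Real.exp (-(3 * h ^ 2)))
        * ENNReal.ofReal (Real.exp (3 * h ^ 2)) := by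
      rw [← ENNReal.ofReal_mul (Real.exp_pos _).le, ← Real.exp_add]; simp
    calc _ = ENNReal.ofReal (Real.exp (-(3 * h ^ 2))) * (ENNReal.ofReal (Real.exp (3 * h ^ 2))
          * P {ω | 4 * √c * h < euclNorm (A ω)}) := by rw [← mul_assoc, ← e1, one_mul]
      _ ≤ ENNReal.ofReal (Real.exp (-(3 * h ^ 2)))
          * ENNReal.ofReal (Real.exp (25 / 32 * h ^ 2) * 5 ^ r) := by gcongr
      _ = ENNReal.ofReal (Real.exp (-(3 * h ^ 2)) * (Real.exp (25 / 32 * h ^ 2) * 5 ^ r)) := by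
          rw [← ENNReal.ofReal_mul (Real.exp_pos _).le]
      _ ≤ ENNReal.ofReal (Real.exp (-(3 * h ^ 2)) * (Real.exp (25 / 32 * h ^ 2)
            * Real.exp (2 * r))) := by
          gcongr
          exact five_pow_le_exp r
      _ ≤ _ := by
          rw [← Real.exp_add, ← Real.exp_add]
          gcongr
          nlinarith
  · intro ω hω
    have hn : 4 * √c * h < euclNorm (A ω) := hω
    have hn0 : 0 < euclNorm (A ω) := lt_of_le_of_lt (by positivity) hn
    set u : EuclideanSpace ℝ (Fin r) := WithLp.toLp 2 ((euclNorm (A ω))⁻¹ • A ω) with hu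
    have hu1 : ‖u‖ = 1 := by
      have : ‖u‖ = |(euclNorm (A ω))⁻¹| * euclNorm (A ω) := euclNorm_smul _ _
      rw [this, abs_of_pos (inv_pos.2 hn0), inv_mul_cancel₀ hn0.ne']
    refine ⟨Metric.ball u (1 / 4), ball_subset_ball_five_quarters hu1,
      Metric.isOpen_ball.measurableSet, (hball u).ge, fun y hy => ?_⟩
    have h1 : euclNorm (WithLp.ofLp u - WithLp.ofLp y) ≤ 1 / 4 := by
      have : ‖u - y‖ < 1 / 4 := by rw [norm_sub_rev, ← dist_eq_norm]; exact hy
      exact this.le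
    have h2 : WithLp.ofLp u ⬝ᵥ A ω = euclNorm (A ω) := by
      have : WithLp.ofLp u ⬝ᵥ A ω = (euclNorm (A ω))⁻¹ * (A ω ⬝ᵥ A ω) := smul_dotProduct _ _ _
      rw [this, ← euclNorm_sq_eq_dotProduct, sq, ← mul_assoc, inv_mul_cancel₀ hn0.ne', one_mul]
    have h3 := dotProduct_le_euclNorm_mul (WithLp.ofLp u - WithLp.ofLp y) (A ω)
    rw [sub_dotProduct, h2] at h3
    have h4 : 3 * √c * h ≤ WithLp.ofLp y ⬝ᵥ A ω := by nlinarith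
    calc 3 * h ^ 2 = h / √c * (3 * √c * h) := by field_simp
      _ ≤ _ := by gcongr
  · intro y hy
    have hy' : euclNorm (WithLp.ofLp y) ≤ 5 / 4 := by
      have : ‖y‖ < 5 / 4 := by rw [← dist_zero_right]; exact hy
      exact this.le
    have h1 := hmgf ((h / √c) • WithLp.ofLp y)
    simp only [smul_dotProduct, smul_eq_mul] at h1
    refine h1.trans (ENNReal.ofReal_le_ofReal (Real.exp_le_exp.2 ?_))
    rw [euclNorm_smul, mul_pow, sq_abs, div_pow, hsc2]
    have h2 : c / 2 * (h ^ 2 / c * euclNorm (WithLp.ofLp y) ^ 2)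
        = h ^ 2 / 2 * euclNorm (WithLp.ofLp y) ^ 2 := by field_simp
    rw [h2]
    have h3 := pow_le_pow_left₀ (euclNorm_nonneg _) hy' 2
    nlinarith [sq_nonneg h]

/-- Tail bound for the operator norm of a random matrix with sub-Gaussian bilinear forms. -/
lemma measure_lt_opNorm_le {Ω : Type*} [MeasurableSpace Ω] (P : Measure Ω)
    [IsProbabilityMeasure P] {m n : ℕ} {Z : Ω → Matrix (Fin m) (Fin n) ℝ}
    (hZ : ∀ i j, Measurable fun ω => Z ω i j) {c : ℝ} (hc : 0 < c)
    (hmgf : ∀ x y, ∫⁻ ω, ENNReal.ofReal (Real.exp (x ⬝ᵥ (Z ω *ᵥ y))) ∂P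
      ≤ ENNReal.ofReal (Real.exp (c / 2 * (euclNorm x ^ 2 * euclNorm y ^ 2)))) :
    P {ω | 12 * √c * √((m : ℝ) + n) < ‖Z ω‖} ≤ ENNReal.ofReal (Real.exp (-((m : ℝ) + n))) := by
  set h := √((m : ℝ) + n) with hh
  have hh0 : 0 ≤ h := by positivity
  have hh2 : h ^ 2 = m + n := Real.sq_sqrt (by positivity)
  have hsc : 0 < √c := Real.sqrt_pos.2 hc
  have hsc2 : √c ^ 2 = c := Real.sq_sqrt hc.le
  set V : ∀ k : ℕ, ℝ≥0∞ := fun k => volume (Metric.ball (0 : EuclideanSpace ℝ (Fin k)) (1 / 4))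
    with hV
  have hball : ∀ k (u : EuclideanSpace ℝ (Fin k)), volume (Metric.ball u (1 / 4)) = V k :=
    fun k u => Measure.addHaar_ball_center _ _ _
  have hV0 : ∀ k, V k ≠ 0 := fun k => (Metric.measure_ball_pos volume _ (by norm_num)).ne'
  have hVt : ∀ k, V k ≠ ∞ := fun k => measure_ball_lt_top.ne
  -- Here the average runs over pairs near a nearly maximising pair of unit vectors. The form keeps
  -- a fraction `15/16 - 1/4 - 5/16 = 3/8` of `‖Z ω‖`, and `12 · 3/8 = 9/2`. The moment exponent is
  -- `(25/16)² h²/2`, and `-9/2 + 625/512 + 2 < -1`.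
  have hmain := measure_mul_le_of_averaging P
    ((volume : Measure (EuclideanSpace ℝ (Fin m))).prod
      (volume : Measure (EuclideanSpace ℝ (Fin n))))
    (f := fun ω τ => h / √c * (WithLp.ofLp τ.1 ⬝ᵥ (Z ω *ᵥ WithLp.ofLp τ.2)))
    (A := {ω | 12 * √c * h < ‖Z ω‖}) (S := Metric.ball 0 (5 / 4) ×ˢ Metric.ball 0 (5 / 4))
    (L := 9 / 2 * h ^ 2)
    (v := V m * V n) (K := ENNReal.ofReal (Real.exp (625 / 512 * h ^ 2))) (by
      unfold Function.uncurry dotProduct Matrix.mulVec dotProduct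
      refine Measurable.const_mul (Finset.measurable_sum _ fun i _ => Measurable.mul ?_
        (Finset.measurable_sum _ fun j _ => Measurable.mul ?_ ?_)) _
      · exact (by fun_prop : Continuous fun y : EuclideanSpace ℝ (Fin m) => y i).measurable.comp
          (measurable_fst.comp measurable_snd)
      · exact (hZ i j).comp measurable_fst
      · exact (by fun_prop : Continuous fun y : EuclideanSpace ℝ (Fin n) => y j).measurable.comp
          (measurable_snd.comp measurable_snd))
    (Metric.isOpen_ball.measurableSet.prod Metric.isOpen_ball.measurableSet) ?_ ?_
  · have e0 : ENNReal.ofReal (5 ^ m) * V m * (ENNReal.ofReal (5 ^ n) * V n)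
        = ENNReal.ofReal (5 ^ m) * ENNReal.ofReal (5 ^ n) * (V m * V n) := by ring
    rw [Measure.prod_prod, volume_ball_five_quarters m 0, volume_ball_five_quarters n 0, hball,
      hball, e0, ← mul_assoc (ENNReal.ofReal (Real.exp (625 / 512 * h ^ 2))),
      mul_right_comm _ (V m * V n)] at hmain
    have h1 := (ENNReal.mul_le_mul_iff_left (mul_ne_zero (hV0 m) (hV0 n))
      (ENNReal.mul_ne_top (hVt m) (hVt n))).1 hmain
    rw [← ENNReal.ofReal_mul (by positivity), ← ENNReal.ofReal_mul (Real.exp_pos _).le] at h1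
    have e1 : (1 : ℝ≥0∞) = ENNReal.ofReal (Real.exp (-(9 / 2 * h ^ 2)))
        * ENNReal.ofReal (Real.exp (9 / 2 * h ^ 2)) := by
      rw [← ENNReal.ofReal_mul (Real.exp_pos _).le, ← Real.exp_add]; simp
    calc _ = ENNReal.ofReal (Real.exp (-(9 / 2 * h ^ 2)))
          * (ENNReal.ofReal (Real.exp (9 / 2 * h ^ 2))
          * P {ω | 12 * √c * h < ‖Z ω‖}) := by rw [← mul_assoc, ← e1, one_mul]
      _ ≤ ENNReal.ofReal (Real.exp (-(9 / 2 * h ^ 2)))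
          * ENNReal.ofReal (Real.exp (625 / 512 * h ^ 2) * (5 ^ m * 5 ^ n)) := by gcongr
      _ = ENNReal.ofReal (Real.exp (-(9 / 2 * h ^ 2)) * (Real.exp (625 / 512 * h ^ 2)
            * (5 ^ m * 5 ^ n))) := by
          rw [← ENNReal.ofReal_mul (Real.exp_pos _).le]
      _ ≤ ENNReal.ofReal (Real.exp (-(9 / 2 * h ^ 2)) * (Real.exp (625 / 512 * h ^ 2)
            * (Real.exp (2 * m) * Real.exp (2 * n)))) := by
          gcongr
          · exact five_pow_le_exp m
          · exact five_pow_le_exp n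
      _ ≤ _ := by
          rw [← Real.exp_add, ← Real.exp_add, ← Real.exp_add]
          gcongr
          nlinarith
  · intro ω hω
    have hn : 12 * √c * h < ‖Z ω‖ := hω
    have hn0 : 0 < ‖Z ω‖ := lt_of_le_of_lt (by positivity) hn
    obtain ⟨w, hw⟩ : ∃ w, 15 / 16 * ‖Z ω‖ * euclNorm w < euclNorm (Z ω *ᵥ w) := by
      by_contra! hcon
      have := opNorm_le_of_euclNorm_le (Z ω) (by positivity) hcon
      linarith
    have hw0 : 0 < euclNorm w := by
      refine euclNorm_pos fun h0 => ?_
      rw [h0, Matrix.mulVec_zero, euclNorm_eq_zero.2 rfl, euclNorm_eq_zero.2 rfl, mul_zero] at hw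
      exact lt_irrefl _ hw
    have hunit : ∀ {k : ℕ} (w : Fin k → ℝ), 0 < euclNorm w →
        ‖(WithLp.toLp 2 ((euclNorm w)⁻¹ • w) : EuclideanSpace ℝ (Fin k))‖ = 1 := by
      intro k w hw
      have : ‖(WithLp.toLp 2 ((euclNorm w)⁻¹ • w) : EuclideanSpace ℝ (Fin k))‖
          = |(euclNorm w)⁻¹| * euclNorm w := euclNorm_smul _ _
      rw [this, abs_of_pos (inv_pos.2 hw), inv_mul_cancel₀ hw.ne']
    set b := (euclNorm w)⁻¹ • w with hb
    have hZb : 15 / 16 * ‖Z ω‖ < euclNorm (Z ω *ᵥ b) := by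
      rw [hb, Matrix.mulVec_smul, euclNorm_smul, abs_of_pos (inv_pos.2 hw0), inv_mul_eq_div,
        lt_div_iff₀ hw0]
      exact hw
    have hZb0 : 0 < euclNorm (Z ω *ᵥ b) := lt_trans (by positivity) hZb
    set a := (euclNorm (Z ω *ᵥ b))⁻¹ • (Z ω *ᵥ b) with ha
    have ha1 : euclNorm a = 1 := hunit _ hZb0
    have hb1 : euclNorm b = 1 := hunit _ hw0
    refine ⟨Metric.ball (WithLp.toLp 2 a) (1 / 4) ×ˢ Metric.ball (WithLp.toLp 2 b) (1 / 4),
      Set.prod_mono (ball_subset_ball_five_quarters ha1) (ball_subset_ball_five_quarters hb1),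
      Metric.isOpen_ball.measurableSet.prod Metric.isOpen_ball.measurableSet, ?_,
      fun τ hτ => ?_⟩
    · rw [Measure.prod_prod, hball, hball]
    obtain ⟨hτ1, hτ2⟩ := hτ
    set x := WithLp.ofLp τ.1 with hx
    set y := WithLp.ofLp τ.2 with hy
    have hxa : euclNorm (a - x) ≤ 1 / 4 := by
      have : ‖WithLp.toLp 2 a - τ.1‖ < 1 / 4 := by rw [norm_sub_rev, ← dist_eq_norm]; exact hτ1
      exact this.le
    have hyb : euclNorm (b - y) ≤ 1 / 4 := by
      have : ‖WithLp.toLp 2 b - τ.2‖ < 1 / 4 := by rw [norm_sub_rev, ← dist_eq_norm]; exact hτ2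
      exact this.le
    have hx54 : euclNorm x ≤ 5 / 4 := by
      have e : x = a - (a - x) := by abel
      rw [e]
      linarith [euclNorm_sub_le a (a - x)]
    have h2 : a ⬝ᵥ (Z ω *ᵥ b) = euclNorm (Z ω *ᵥ b) := by
      rw [ha, smul_dotProduct, smul_eq_mul, ← euclNorm_sq_eq_dotProduct, sq, ← mul_assoc,
        inv_mul_cancel₀ hZb0.ne', one_mul]
    have h3 : (a - x) ⬝ᵥ (Z ω *ᵥ b) ≤ 1 / 4 * ‖Z ω‖ := by
      have h5 := euclNorm_mulVec_le (Z ω) b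
      rw [hb1, mul_one] at h5
      exact (dotProduct_le_euclNorm_mul _ _).trans
        (mul_le_mul hxa h5 (euclNorm_nonneg _) (by norm_num))
    have h4 : x ⬝ᵥ (Z ω *ᵥ (b - y)) ≤ 5 / 4 * (‖Z ω‖ * (1 / 4)) := by
      have h5 := (euclNorm_mulVec_le (Z ω) (b - y)).trans
        (mul_le_mul_of_nonneg_left hyb hn0.le)
      exact (dotProduct_le_euclNorm_mul _ _).trans
        (mul_le_mul hx54 h5 (euclNorm_nonneg _) (by norm_num))
    rw [sub_dotProduct, h2] at h3
    rw [Matrix.mulVec_sub, dotProduct_sub] at h4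
    have h6 : 9 / 2 * √c * h ≤ x ⬝ᵥ (Z ω *ᵥ y) := by linarith
    calc 9 / 2 * h ^ 2 = h / √c * (9 / 2 * √c * h) := by field_simp
      _ ≤ _ := by gcongr
  · rintro ⟨x, y⟩ ⟨hx, hy⟩
    have hx' : euclNorm (WithLp.ofLp x) ≤ 5 / 4 := by
      have : ‖x‖ < 5 / 4 := by rw [← dist_zero_right]; exact hx
      exact this.le
    have hy' : euclNorm (WithLp.ofLp y) ≤ 5 / 4 := by
      have : ‖y‖ < 5 / 4 := by rw [← dist_zero_right]; exact hy
      exact this.le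
    have h1 := hmgf ((h / √c) • WithLp.ofLp x) (WithLp.ofLp y)
    simp only [smul_dotProduct, smul_eq_mul] at h1
    refine h1.trans (ENNReal.ofReal_le_ofReal (Real.exp_le_exp.2 ?_))
    rw [euclNorm_smul, mul_pow, sq_abs, div_pow, hsc2]
    have h2 : c / 2 * (h ^ 2 / c * euclNorm (WithLp.ofLp x) ^ 2 * euclNorm (WithLp.ofLp y) ^ 2)
        = h ^ 2 / 2 * (euclNorm (WithLp.ofLp x) ^ 2 * euclNorm (WithLp.ofLp y) ^ 2) := by
      field_simp
    rw [h2]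
    have h3 := pow_le_pow_left₀ (euclNorm_nonneg _) hx' 2
    have h4 := pow_le_pow_left₀ (euclNorm_nonneg _) hy' 2
    have h5 := mul_le_mul h3 h4 (sq_nonneg _) (by norm_num)
    nlinarith [sq_nonneg h]

end Averaging
-- Exponential moments of linear forms in the noise
section Noise

variable {Ω : Type*} [MeasurableSpace Ω] {P : Measure Ω} {m n : ℕ}
  {Z : Ω → Matrix (Fin m) (Fin n) ℝ} {a sig : ℝ}

lemma IsSubGaussianNoise.transpose (h : IsSubGaussianNoise P Z a sig) :
    IsSubGaussianNoise P (fun ω => (Z ω)ᵀ) a sig where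
  measurable i j := h.measurable j i
  indep := h.indep.precomp (g := Prod.swap) Prod.swap_injective
  identDistrib i j i' j' := h.identDistrib j i j' i'
  mean_zero i j := h.mean_zero j i
  integrable_exp i j := h.integrable_exp j i
  mgf_le i j := h.mgf_le j i

/-- Linear forms of the noise matrix are sub-Gaussian. -/
lemma IsSubGaussianNoise.lintegral_exp_le (h : IsSubGaussianNoise P Z a sig) (ha : 0 < a)
    (w : Fin m × Fin n → ℝ) :
    ∫⁻ ω, ENNReal.ofReal (Real.exp (∑ p, w p * Z ω p.1 p.2)) ∂P
      ≤ ENNReal.ofReal (Real.exp (sig ^ 2 / a / 2 * ∑ p, w p ^ 2)) := by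
  set c : ℝ≥0 := ⟨sig ^ 2 / a, by positivity⟩ with hc
  have h1 : ∀ p : Fin m × Fin n, HasSubgaussianMGF (fun ω => Z ω p.1 p.2) c P := fun p =>
    ⟨h.integrable_exp p.1 p.2, fun t => by
      refine (h.mgf_le p.1 p.2 t).trans_eq ?_
      congr 1
      change _ = sig ^ 2 / a * t ^ 2 / 2
      field_simp⟩
  have h2 := fun p => (h1 p).const_mul (w p)
  have h3 : iIndepFun (fun (p : Fin m × Fin n) ω => w p * Z ω p.1 p.2) P :=
    h.indep.comp (fun p x => w p * x) fun p => measurable_const_mul _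
  have h4 := HasSubgaussianMGF.sum_of_iIndepFun h3 (s := Finset.univ) fun p _ => h2 p
  have h5 := h4.integrable_exp_mul 1
  have h6 := h4.mgf_le 1
  simp only [one_mul] at h5
  rw [← ofReal_integral_eq_lintegral_ofReal h5
    (Filter.Eventually.of_forall fun ω => (Real.exp_pos _).le)]
  refine ENNReal.ofReal_le_ofReal ?_
  unfold mgf at h6
  simp only [one_mul] at h6
  refine h6.trans_eq ?_
  congr 1
  push_cast
  rw [one_pow, mul_one, Finset.mul_sum, Finset.sum_div]
  refine Finset.sum_congr rfl fun p _ => ?_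
  change w p ^ 2 * (sig ^ 2 / a) / 2 = _
  ring

lemma IsSubGaussianNoise.lintegral_exp_bilin_le (h : IsSubGaussianNoise P Z a sig) (ha : 0 < a)
    (x : Fin m → ℝ) (y : Fin n → ℝ) :
    ∫⁻ ω, ENNReal.ofReal (Real.exp (x ⬝ᵥ (Z ω *ᵥ y))) ∂P
      ≤ ENNReal.ofReal (Real.exp (sig ^ 2 / a / 2 * (euclNorm x ^ 2 * euclNorm y ^ 2))) := by
  have h1 := h.lintegral_exp_le ha fun p => x p.1 * y p.2
  have e1 : ∀ ω, ∑ p : Fin m × Fin n, x p.1 * y p.2 * Z ω p.1 p.2 = x ⬝ᵥ (Z ω *ᵥ y) := by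
    intro ω
    rw [Fintype.sum_prod_type, dotProduct]
    refine Finset.sum_congr rfl fun i _ => ?_
    rw [Matrix.mulVec, dotProduct, Finset.mul_sum]
    exact Finset.sum_congr rfl fun j _ => by ring
  have e2 : ∑ p : Fin m × Fin n, (x p.1 * y p.2) ^ 2 = euclNorm x ^ 2 * euclNorm y ^ 2 := by
    rw [Fintype.sum_prod_type, euclNorm_sq, euclNorm_sq, Finset.sum_mul_sum]
    simp only [mul_pow]
  simp only [e1, e2] at h1
  exact h1

lemma IsSubGaussianNoise.lintegral_exp_col_le (h : IsSubGaussianNoise P Z a sig) (ha : 0 < a)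
    (x : Fin m → ℝ) (j : Fin n) :
    ∫⁻ ω, ENNReal.ofReal (Real.exp (x ⬝ᵥ fun i => Z ω i j)) ∂P
      ≤ ENNReal.ofReal (Real.exp (sig ^ 2 / a / 2 * euclNorm x ^ 2)) := by
  have h1 := h.lintegral_exp_bilin_le ha x (Pi.single j 1)
  have e : euclNorm (Pi.single j 1 : Fin n → ℝ) ^ 2 = 1 := by
    rw [euclNorm_sq_eq_dotProduct]; simp
  simp only [Matrix.mulVec_single_one, e, mul_one] at h1
  exact h1

end Noise

/-! ### The high probability event for the projected noise columns -/

section LeaveOneOutEvent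

instance instMeasurableSpaceMatrix {m n : ℕ} : MeasurableSpace (Matrix (Fin m) (Fin n) ℝ) :=
  MeasurableSpace.pi

instance instBorelSpaceMatrix {m n : ℕ} : BorelSpace (Matrix (Fin m) (Fin n) ℝ) :=
  inferInstanceAs (BorelSpace (Fin m → Fin n → ℝ))

lemma measurable_matrix_iff {Ω : Type*} [MeasurableSpace Ω] {m n : ℕ}
    {Z : Ω → Matrix (Fin m) (Fin n) ℝ} : Measurable Z ↔ ∀ i j, Measurable fun ω => Z ω i j :=
  measurable_pi_iff.trans (forall_congr' fun _ => measurable_pi_iff)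

variable {Ω : Type*} [MeasurableSpace Ω] {P : Measure Ω} {m n r : ℕ}
  {Z : Ω → Matrix (Fin m) (Fin n) ℝ} {a sig : ℝ}

/-- The two sides are measurable functions of the entries outside column `j` and of those in it, two
disjoint families of independent variables. -/
lemma IsSubGaussianNoise.indepFun_dropCol [IsProbabilityMeasure P] (h : IsSubGaussianNoise P Z a sig) (j : Fin n) :
    IndepFun (fun ω => dropCol (Z ω) j) (fun ω i => Z ω i j) P := by
  classical
  set S : Finset (Fin m × Fin n) := Finset.univ.filter fun p => p.2 ≠ j with hS
  set T : Finset (Fin m × Fin n) := Finset.univ.filter fun p => p.2 = j with hT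
  have hST : Disjoint S T := by
    rw [Finset.disjoint_left]
    intro p hp hp'
    exact (Finset.mem_filter.1 hp).2 (Finset.mem_filter.1 hp').2
  have h1 := h.indep.indepFun_finset S T hST fun p => h.measurable p.1 p.2
  let φ : (S → ℝ) → Matrix (Fin m) (Fin n) ℝ := fun w =>
    Matrix.of fun i k => if hp : (i, k) ∈ S then w ⟨(i, k), hp⟩ else 0
  let ψ : (T → ℝ) → Fin m → ℝ := fun w i => w ⟨(i, j), by simp [hT]⟩
  have hφ : Measurable φ := by
    refine measurable_matrix_iff.2 fun i k => ?_
    simp only [φ, Matrix.of_apply]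
    split_ifs
    · exact measurable_pi_apply _
    · exact measurable_const
  have hψ : Measurable ψ := measurable_pi_iff.2 fun i => measurable_pi_apply _
  have h2 := h1.comp hφ hψ
  have e : (φ ∘ fun ω (p : S) => Z ω p.1.1 p.1.2) = fun ω => dropCol (Z ω) j := by
    funext ω
    ext i k
    by_cases hk : k = j <;> simp [φ, dropCol, hS, hk]
  rw [e] at h2
  exact h2

lemma measurable_dropCol (h : IsSubGaussianNoise P Z a sig) (j : Fin n) :
    Measurable fun ω => dropCol (Z ω) j := by
  refine measurable_matrix_iff.2 fun i k => ?_
  by_cases hk : k = j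
  · simp [dropCol, hk]
  · simpa [dropCol, hk] using h.measurable i k

/-- A random projection of rank at most `r`, applied to a noise column that is independent of
it. -/
lemma IsSubGaussianNoise.measure_lt_euclNorm_mulVec_le [IsProbabilityMeasure P] (h : IsSubGaussianNoise P Z a sig)
    (ha : 0 < a) (hsig : 0 < sig) {x : ℝ} (hx : 0 ≤ x) (j : Fin n)
    {Q : Matrix (Fin m) (Fin n) ℝ → Matrix (Fin m) (Fin m) ℝ} (hQ : Measurable Q)
    (hrank : ∀ Y, ∃ U : Matrix (Fin m) (Fin r) ℝ, Uᵀ * U = 1 ∧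
      ∀ v, euclNorm (Q Y *ᵥ v) ≤ euclNorm (Uᵀ *ᵥ v)) :
    P {ω | 4 * √(sig ^ 2 / a) * (√r + √x) < euclNorm (Q (dropCol (Z ω) j) *ᵥ fun i => Z ω i j)}
      ≤ ENNReal.ofReal (Real.exp (-(2 * x))) := by
  set t := 4 * √(sig ^ 2 / a) * (√r + √x) with ht
  have hc : 0 < sig ^ 2 / a := by positivity
  have hmW := measurable_dropCol h j
  have hmz : Measurable fun ω i => Z ω i j := measurable_pi_iff.2 fun i => h.measurable i j
  set D : Set (Matrix (Fin m) (Fin n) ℝ × (Fin m → ℝ)) :=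
    {y | t < euclNorm (Q y.1 *ᵥ y.2)} with hD
  have hDm : MeasurableSet D := by
    have h1 : Measurable fun y : Matrix (Fin m) (Fin n) ℝ × (Fin m → ℝ) => Q y.1 *ᵥ y.2 := by
      refine measurable_pi_iff.2 fun i => ?_
      unfold Matrix.mulVec dotProduct
      refine Finset.measurable_sum _ fun k _ => Measurable.mul ?_ ?_
      · exact (measurable_matrix_iff.1 hQ i k).comp measurable_fst
      · exact (measurable_pi_apply k).comp measurable_snd
    have h2 : Measurable (euclNorm : (Fin m → ℝ) → ℝ) :=
      (by unfold euclNorm; fun_prop : Continuous (euclNorm : (Fin m → ℝ) → ℝ)).measurable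
    exact measurableSet_lt measurable_const (h2.comp h1)
  have e : P {ω | t < euclNorm (Q (dropCol (Z ω) j) *ᵥ fun i => Z ω i j)}
      = (P.map fun ω => (dropCol (Z ω) j, fun i => Z ω i j)) D := by
    rw [Measure.map_apply (hmW.prodMk hmz) hDm]; rfl
  have := Measure.isProbabilityMeasure_map (μ := P) hmW.aemeasurable
  have := Measure.isProbabilityMeasure_map (μ := P) hmz.aemeasurable
  -- By independence and Fubini the other columns can be frozen at a value `Y`. Then only `Uᵀ z`
  -- matters, a sub-Gaussian vector of dimension `r` rather than `m`.
  rw [e, (indepFun_iff_map_prod_eq_prod_map_map hmW.aemeasurable hmz.aemeasurable).1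
    (h.indepFun_dropCol j), Measure.prod_apply hDm]
  refine (lintegral_mono fun Y => ?_).trans_eq (lintegral_const _) |>.trans_eq (by
    rw [measure_univ, mul_one])
  obtain ⟨U, hU, hUQ⟩ := hrank Y
  rw [Measure.map_apply hmz (measurable_prodMk_left hDm)]
  have hsub : (fun ω i => Z ω i j) ⁻¹' (Prod.mk Y ⁻¹' D)
      ⊆ {ω | t < euclNorm (Uᵀ *ᵥ fun i => Z ω i j)} := fun ω hω =>
    lt_of_lt_of_le hω (hUQ _)
  refine (measure_mono hsub).trans ?_
  refine measure_lt_euclNorm_le P (A := fun ω => Uᵀ *ᵥ fun i => Z ω i j) (fun k => ?_) hc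
    (fun y => ?_) hx
  · unfold Matrix.mulVec dotProduct
    exact Finset.measurable_sum _ fun i _ => (h.measurable i j).const_mul _
  · have h1 := h.lintegral_exp_col_le ha (U *ᵥ y) j
    rw [euclNorm_mulVec_of_transpose_mul_self hU] at h1
    have e1 : ∀ ω, (U *ᵥ y) ⬝ᵥ (fun i => Z ω i j) = y ⬝ᵥ (Uᵀ *ᵥ fun i => Z ω i j) := fun ω => by
      rw [Matrix.dotProduct_mulVec, Matrix.vecMul_transpose]
    simpa only [e1] using h1

variable {lam : Fin r → ℝ} {R : Fin r → Finset (Fin m)} {C : Fin r → Finset (Fin n)} {β B Q : ℝ}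

lemma IsSeparated.le_dim (h : IsSeparated lam R C β B Q) : r ≤ m := by
  have hinj : Function.Injective (Matrix.mulVecLin (supportMatrix R)) :=
    (injective_iff_map_eq_zero _).2 fun v hv => h.supportMatrix_injective v hv
  simpa using LinearMap.finrank_le_finrank_of_injective hinj

/-- The eigenvectors are chosen arbitrarily and need not depend measurably on the matrix. Where the
noise is small a uniform spectral gap makes the projection Lipschitz in the Gram matrix, which
supplies the measurability needed for Fubini. -/
lemma IsSeparated.continuousOn_spectralProj (h : IsSeparated lam R C β B Q) :
    ContinuousOn (fun Y => spectralProj r (signal lam R C + Y)) {Y | ‖Y‖ < β * √Q / 4} := by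
  have hg : 0 < β * √Q := mul_pos h.pos (Real.sqrt_pos.2 (zero_lt_one.trans_le h.one_le))
  set g := β * √Q with hgdef
  intro Y hY
  have hsplit : ∀ Y ∈ {Y : Matrix (Fin m) (Fin n) ℝ | ‖Y‖ < g / 4}, IsSpectralSplit
      ((signal lam R C + Y) * (signal lam R C + Y)ᵀ) (spectralProj r (signal lam R C + Y))
      ((g - g / 4) ^ 2) ((g / 4) ^ 2) := fun Y hY =>
    h.isSpectralSplit_spectralProj rfl (le_of_lt hY) (by linarith)
  have hcont : Continuous fun Y : Matrix (Fin m) (Fin n) ℝ =>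
      (signal lam R C + Y) * (signal lam R C + Y)ᵀ := by fun_prop
  rw [ContinuousWithinAt, tendsto_iff_norm_sub_tendsto_zero]
  have hlim := ((hcont.tendsto Y).mono_left (nhdsWithin_le_nhds (s := {Y | ‖Y‖ < g / 4})))
  rw [tendsto_iff_norm_sub_tendsto_zero] at hlim
  have hlim' := hlim.const_mul (4 / g ^ 2)
  rw [mul_zero] at hlim'
  refine squeeze_zero' (Filter.Eventually.of_forall fun _ => norm_nonneg _) ?_ hlim'
  filter_upwards [self_mem_nhdsWithin] with Y' hY'
  have h1 := (hsplit Y' hY').norm_sub_le (pow_pos (by linarith) 2) (hsplit Y hY)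
  have e : (g - g / 4) ^ 2 - (g / 4) ^ 2 = g ^ 2 / 2 := by ring
  rw [e] at h1
  rw [div_mul_eq_mul_div, le_div_iff₀ (by positivity)]
  linarith

lemma exists_spectralProj_factor (hr : r ≤ m) (X : Matrix (Fin m) (Fin n) ℝ) :
    ∃ U : Matrix (Fin m) (Fin r) ℝ, Uᵀ * U = 1 ∧ spectralProj r X = U * Uᵀ := by
  have hU := (exists_isOrderedEigen X).choose_spec.choose_spec.orthonormal
  exact ⟨_, submatrix_castLE_transpose_mul hr hU, (submatrix_castLE_mul_transpose hr _).symm⟩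

/-- With high probability, small operator norm of the noise is all that is needed for
`IsSmallNoise`. -/
lemma IsSeparated.exists_event [IsProbabilityMeasure P] (hs : IsSeparated lam R C β B Q)
    (h : IsSubGaussianNoise P Z a sig) (ha : 0 < a) (hsig : 0 < sig) (hn : 1 ≤ n)
    (hβ : 4 * √(sig ^ 2 / a) * (√r + √(Real.log n)) ≤ β / (100 * B)) :
    ∃ E : Set Ω, MeasurableSet E ∧ P Eᶜ ≤ ENNReal.ofReal ((n : ℝ) ^ (-1 : ℝ)) ∧
      ∀ ω ∈ E, ‖Z ω‖ ≤ β * √Q / (100 * B) → IsSmallNoise lam R C β B Q (Z ω) := by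
  classical
  have hn0 : (0 : ℝ) < n := by exact_mod_cast hn
  have hlog : 0 ≤ Real.log n := Real.log_nonneg (by exact_mod_cast hn)
  have hg : 0 < β * √Q := mul_pos hs.pos (Real.sqrt_pos.2 (zero_lt_one.trans_le hs.one_le))
  set G : Set (Matrix (Fin m) (Fin n) ℝ) := {Y | ‖Y‖ < β * √Q / 4} with hG
  have hGm : MeasurableSet G := measurableSet_lt measurable_norm measurable_const
  -- Setting the projection to zero off `G` gives a globally measurable map, unchanged on the event
  -- that the noise norm is small.
  set F : Matrix (Fin m) (Fin n) ℝ → Matrix (Fin m) (Fin m) ℝ :=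
    G.piecewise (fun Y => spectralProj r (signal lam R C + Y)) (fun _ => 0) with hF
  have hFm : Measurable F :=
    hs.continuousOn_spectralProj.measurable_piecewise continuousOn_const hGm
  have hrank : ∀ Y, ∃ U : Matrix (Fin m) (Fin r) ℝ, Uᵀ * U = 1 ∧
      ∀ v, euclNorm (F Y *ᵥ v) ≤ euclNorm (Uᵀ *ᵥ v) := by
    intro Y
    obtain ⟨U, hU, hP⟩ := exists_spectralProj_factor hs.le_dim (signal lam R C + Y)
    refine ⟨U, hU, fun v => ?_⟩
    by_cases hY : Y ∈ G
    · rw [hF, Set.piecewise_eq_of_mem _ _ _ hY, hP, ← Matrix.mulVec_mulVec,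
        euclNorm_mulVec_of_transpose_mul_self hU]
    · rw [hF, Set.piecewise_eq_of_notMem _ _ _ hY, Matrix.zero_mulVec, euclNorm_eq_zero.2 rfl]
      exact euclNorm_nonneg _
  set bad : Fin n → Set Ω := fun j => {ω | 4 * √(sig ^ 2 / a) * (√r + √(Real.log n))
    < euclNorm (F (dropCol (Z ω) j) *ᵥ fun i => Z ω i j)} with hbad
  have hbadm : ∀ j, MeasurableSet (bad j) := by
    intro j
    have h1 : Measurable fun ω => F (dropCol (Z ω) j) *ᵥ fun i => Z ω i j := by
      refine measurable_pi_iff.2 fun i => ?_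
      unfold Matrix.mulVec dotProduct
      exact Finset.measurable_sum _ fun k _ => Measurable.mul
        (measurable_matrix_iff.1 (hFm.comp (measurable_dropCol h j)) i k) (h.measurable k j)
    have h2 : Measurable (euclNorm : (Fin m → ℝ) → ℝ) :=
      (by unfold euclNorm; fun_prop : Continuous (euclNorm : (Fin m → ℝ) → ℝ)).measurable
    exact measurableSet_lt measurable_const (h2.comp h1)
  refine ⟨(⋃ j, bad j)ᶜ, (MeasurableSet.iUnion hbadm).compl, ?_, fun ω hω hZ => ⟨hZ, fun j => ?_⟩⟩
  · rw [compl_compl]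
    -- Union bound: `n` columns, each failing with probability at most `exp(-2 log n) = n⁻²`.
    refine (measure_iUnion_fintype_le P bad).trans ?_
    refine (Finset.sum_le_sum fun j _ =>
      h.measure_lt_euclNorm_mulVec_le ha hsig hlog j hFm hrank).trans ?_
    rw [Finset.sum_const, Finset.card_univ, Fintype.card_fin, nsmul_eq_mul,
      ← ENNReal.ofReal_natCast, ← ENNReal.ofReal_mul hn0.le]
    refine ENNReal.ofReal_le_ofReal (le_of_eq ?_)
    have e : Real.exp (-(2 * Real.log n)) = (n : ℝ) ^ (-2 : ℝ) := by
      rw [Real.rpow_def_of_pos hn0]; congr 1; ring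
    rw [e]
    nth_rewrite 1 [← Real.rpow_one (n : ℝ)]
    rw [← Real.rpow_add hn0]
    norm_num
  · have h1 : ω ∉ bad j := fun hj => hω (Set.mem_iUnion.2 ⟨j, hj⟩)
    have h2 := (not_lt.1 h1).trans hβ
    have h3 : dropCol (Z ω) j ∈ G := by
      refine lt_of_le_of_lt ((opNorm_dropCol_le _ j).trans hZ) ?_
      have := hs.one_le_ratio
      gcongr
      linarith
    rwa [hF, Set.piecewise_eq_of_mem _ _ _ h3] at h2

end LeaveOneOutEvent
-- Translating the signal to noise condition into thresholds
section Constants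

variable {m n r : ℕ} {K km kn lam₀ sig a C₀ : ℝ} {lam : Fin r → ℝ} {R : Fin r → Finset (Fin m)}
  {C : Fin r → Finset (Fin n)}

/-- Each of `lam s` and `|R s|` varies by a factor `K` either way, so `lam s √|R s|` lies within a
factor `K√K` of `lam₀ √km`: this gives `β` and the ratio `K³`. The 1 in `Q` is allowed because the
cluster sizes are positive integers. -/
lemma isSeparated_of_comparable (hK : 1 ≤ K) (hkm : 0 < km) (hkn : 0 < kn) (hlam₀ : 0 < lam₀)
    (hR : ∀ s t, s ≠ t → Disjoint (R s) (R t)) (hC : ∀ s t, s ≠ t → Disjoint (C s) (C t))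
    (hRs : ∀ s, km ≤ K * ((R s).card : ℝ) ∧ ((R s).card : ℝ) ≤ K * km)
    (hCs : ∀ s, kn ≤ K * ((C s).card : ℝ) ∧ ((C s).card : ℝ) ≤ K * kn)
    (hlam : ∀ s, lam₀ ≤ K * lam s ∧ lam s ≤ K * lam₀)
    (hbg : kn ≤ K * ((n : ℝ) - ∑ s, ((C s).card : ℝ))) :
    IsSeparated lam R C (lam₀ * √km / (K * √K)) (K ^ 3) (max 1 (kn / K)) := by
  have hK0 : 0 < K := zero_lt_one.trans_le hK
  have hsK : 0 < √K := Real.sqrt_pos.2 hK0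
  have hsK2 : √K * √K = K := Real.mul_self_sqrt hK0.le
  have hskm : 0 < √km := Real.sqrt_pos.2 hkm
  have hlamlow : ∀ s, lam₀ / K ≤ lam s := fun s => by
    rw [div_le_iff₀' hK0]; exact (hlam s).1
  refine ⟨hR, hC, by positivity, one_le_pow₀ hK, le_max_left _ _, fun s => ?_, fun s => ?_,
    fun s => max_le ?_ ?_, max_le ?_ ?_⟩
  · have h1 : √km / √K ≤ √((R s).card) := by
      rw [← Real.sqrt_div hkm.le]
      refine Real.sqrt_le_sqrt ?_
      rw [div_le_iff₀' hK0]; exact (hRs s).1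
    calc lam₀ * √km / (K * √K) = lam₀ / K * (√km / √K) := by field_simp
      _ ≤ _ := mul_le_mul (hlamlow s) h1 (by positivity)
        ((div_pos hlam₀ hK0).le.trans (hlamlow s))
  · have h1 : √((R s).card) ≤ √K * √km := by
      rw [← Real.sqrt_mul hK0.le]
      exact Real.sqrt_le_sqrt (hRs s).2
    calc lam s * √((R s).card) ≤ (K * lam₀) * (√K * √km) :=
          mul_le_mul (hlam s).2 h1 (Real.sqrt_nonneg _) (by positivity)
      _ = K ^ 3 * (lam₀ * √km / (K * √K)) := by
          have h2 : K ^ 3 * (lam₀ * √km / (K * √K)) = K * (√K * √K) * (lam₀ * √km) / √K := by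
            rw [hsK2]; field_simp
          rw [h2]; field_simp
  · have h1 : (0 : ℝ) < (C s).card := pos_of_mul_pos_right (hkn.trans_le (hCs s).1) hK0.le
    exact_mod_cast h1
  · rw [div_le_iff₀' hK0]; exact (hCs s).1
  · have h1 : (0 : ℝ) < (n : ℝ) - ∑ s, ((C s).card : ℝ) :=
      pos_of_mul_pos_right (hkn.trans_le hbg) hK0.le
    have h2 : (0 : ℤ) < (n : ℤ) - ∑ s, ((C s).card : ℤ) := by exact_mod_cast h1
    have h3 : (1 : ℤ) ≤ (n : ℤ) - ∑ s, ((C s).card : ℤ) := h2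
    exact_mod_cast h3
  · rw [div_le_iff₀' hK0]; exact hbg

lemma proj_threshold_le (ha : 0 < a) (hK : 1 ≤ K) (hkm : 0 < km) (hkn : 0 < kn)
    (hsig : 0 < sig) {x : ℝ}
    (hsnr : 2400 * K ^ 5 / √a * (√(r / min km kn) + √(x / km)) ≤ lam₀ / sig) :
    4 * √(sig ^ 2 / a) * (√r + √x) ≤ lam₀ * √km / (K * √K) / (100 * K ^ 3) := by
  have hK0 : 0 < K := zero_lt_one.trans_le hK
  have hsK : 0 < √K := Real.sqrt_pos.2 hK0
  have hsK1 : √K ≤ K := by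
    rw [Real.sqrt_le_left hK0.le]; nlinarith
  have hsa : 0 < √a := Real.sqrt_pos.2 ha
  have hskm : 0 < √km := Real.sqrt_pos.2 hkm
  have h1 : √r / √km ≤ √(r / min km kn) := by
    rw [← Real.sqrt_div (Nat.cast_nonneg r)]
    refine Real.sqrt_le_sqrt ?_
    have := lt_min hkm hkn
    gcongr
    exact min_le_left _ _
  have h2 : √x / √km = √(x / km) := (Real.sqrt_div' x hkm.le).symm
  have h3 : 2400 * K ^ 5 / √a * (√r / √km + √x / √km) ≤ lam₀ / sig := by
    refine le_trans ?_ hsnr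
    rw [h2]
    gcongr
  have h4 : 2400 * K ^ 5 * sig * (√r + √x) ≤ lam₀ * √km * √a := by
    have e : 2400 * K ^ 5 / √a * (√r / √km + √x / √km)
        = 2400 * K ^ 5 * (√r + √x) / (√a * √km) := by field_simp
    rw [e, div_le_div_iff₀ (by positivity) hsig] at h3
    linarith
  rw [Real.sqrt_div (sq_nonneg sig), Real.sqrt_sq hsig.le, div_div, le_div_iff₀ (by positivity)]
  have h5 : K ^ 4 * √K ≤ K ^ 5 := by
    calc K ^ 4 * √K ≤ K ^ 4 * K := by gcongr
      _ = K ^ 5 := by ring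
  have h6 : 400 * (K ^ 4 * √K) * sig * (√r + √x) ≤ 2400 * K ^ 5 * sig * (√r + √x) := by
    have : 400 * (K ^ 4 * √K) ≤ 2400 * K ^ 5 := by nlinarith [pow_pos hK0 5]
    gcongr
  calc 4 * (sig / √a) * (√r + √x) * (K * √K * (100 * K ^ 3))
      = 400 * (K ^ 4 * √K) * sig * (√r + √x) / √a := by field_simp; ring
    _ ≤ lam₀ * √km := by
        rw [div_le_iff₀ hsa]
        linarith

/-- This threshold fixes the constant: 12 from the operator norm tail, 2 from `√(m + n) ≤ 2 √(max m
n)`, `100 K³` from the smallness required of the noise, and `K √K · √K = K²` from `β` and `√Q`. The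
projection threshold needs only `400 K⁴ √K`. -/
lemma norm_threshold_le (ha : 0 < a) (hK : 1 ≤ K) (hkm : 0 < km) (hkn : 0 < kn)
    (hlam₀ : 0 < lam₀) (hsig : 0 < sig)
    (hsnr : 2400 * K ^ 5 / √a * √(max (m : ℝ) n / (km * kn)) ≤ lam₀ / sig) :
    12 * √(sig ^ 2 / a) * √((m : ℝ) + n)
      ≤ lam₀ * √km / (K * √K) * √(max 1 (kn / K)) / (100 * K ^ 3) := by
  have hK0 : 0 < K := zero_lt_one.trans_le hK
  have hsK : 0 < √K := Real.sqrt_pos.2 hK0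
  have hsK2 : √K * √K = K := Real.mul_self_sqrt hK0.le
  have hsa : 0 < √a := Real.sqrt_pos.2 ha
  have hskm : 0 < √km := Real.sqrt_pos.2 hkm
  have hskn : 0 < √kn := Real.sqrt_pos.2 hkn
  have h1 : √((m : ℝ) + n) ≤ 2 * √(max (m : ℝ) n) := by
    have h0 : (0 : ℝ) ≤ max (m : ℝ) n := le_max_of_le_left (Nat.cast_nonneg m)
    rw [Real.sqrt_le_left (by positivity), mul_pow, Real.sq_sqrt h0]
    linarith [le_max_left (m : ℝ) n, le_max_right (m : ℝ) n]
  have h2 : √kn / √K ≤ √(max 1 (kn / K)) := by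
    rw [← Real.sqrt_div hkn.le]
    exact Real.sqrt_le_sqrt (le_max_right _ _)
  have h4 : 2400 * K ^ 5 * sig * √(max (m : ℝ) n) ≤ lam₀ * (√km * √kn) * √a := by
    rw [Real.sqrt_div' _ (by positivity), Real.sqrt_mul hkm.le, div_mul_div_comm,
      div_le_div_iff₀ (by positivity) hsig] at hsnr
    linarith
  rw [Real.sqrt_div (sq_nonneg sig), Real.sqrt_sq hsig.le]
  calc 12 * (sig / √a) * √((m : ℝ) + n) ≤ 12 * (sig / √a) * (2 * √(max (m : ℝ) n)) := by gcongr
    _ = 2400 * K ^ 5 * sig * √(max (m : ℝ) n) / (100 * K ^ 5 * √a) := by field_simp; ring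
    _ ≤ lam₀ * (√km * √kn) * √a / (100 * K ^ 5 * √a) := by gcongr
    _ = lam₀ * (√km * √kn) / (K * (√K * √K) * (100 * K ^ 3)) := by
        rw [hsK2]; field_simp
    _ = lam₀ * √km / (K * √K) * (√kn / √K) / (100 * K ^ 3) := by field_simp
    _ ≤ _ := by gcongr

end Constants
end SubmatrixLocalization

/-! ### Assembly of the main theorem -/

open SubmatrixLocalization
open scoped Matrix Matrix.Norms.L2Operator

theorem mainTheorem5 (a K : ℝ) (ha : 0 < a) (hK : 1 ≤ K) :
    ∃ C₀ c₀ : ℝ, 0 < C₀ ∧ 0 < c₀ ∧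
      ∀ (m n r : ℕ) (km kn lam₀ sig : ℝ) (lam : Fin r → ℝ)
        (R : Fin r → Finset (Fin m)) (C : Fin r → Finset (Fin n))
        (Ω : Type*) [MeasurableSpace Ω] (P : Measure Ω) [IsProbabilityMeasure P]
        (Z : Ω → Matrix (Fin m) (Fin n) ℝ),
        1 ≤ r → 0 < km → 0 < kn → 0 < lam₀ → 0 < sig →
        -- non-overlapping submatrices
        (∀ s t, s ≠ t → Disjoint (R s) (R t)) →
        (∀ s t, s ≠ t → Disjoint (C s) (C t)) →
        -- comparable sizes and magnitudes
        (∀ s, km ≤ K * ((R s).card : ℝ) ∧ ((R s).card : ℝ) ≤ K * km) →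
        (∀ s, kn ≤ K * ((C s).card : ℝ) ∧ ((C s).card : ℝ) ≤ K * kn) →
        (∀ s, lam₀ ≤ K * lam s ∧ lam s ≤ K * lam₀) →
        -- the background rows and columns are at least as many, up to the constant
        km ≤ K * ((m : ℝ) - ∑ s, ((R s).card : ℝ)) →
        kn ≤ K * ((n : ℝ) - ∑ s, ((C s).card : ℝ)) →
        -- dense regime
        max (Real.sqrt m) (Real.sqrt n) ≤ K * min km kn →
        SubmatrixLocalization.IsSubGaussianNoise P Z a sig →
        -- signal to noise ratio
        C₀ * (Real.sqrt (r / min km kn)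
            + max (Real.sqrt (Real.log n / km)) (Real.sqrt (Real.log m / kn))
            + Real.sqrt (max (m : ℝ) n / (km * kn))) ≤ lam₀ / sig →
        ∃ E : Set Ω, MeasurableSet E ∧
          1 - (m : ℝ) ^ (-c₀) - (n : ℝ) ^ (-c₀) - 2 * Real.exp (-c₀ * ((m : ℝ) + n)) ≤ P.real E ∧
          ∀ ω ∈ E, SubmatrixLocalization.SpectralSucceeds
            (SubmatrixLocalization.signal lam R C + Z ω) R C := by
  have hK0 : 0 < K := zero_lt_one.trans_le hK
  have hC₀ : 0 < 2400 * K ^ 5 / √a := by positivity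
  refine ⟨2400 * K ^ 5 / √a, 1, hC₀, one_pos, ?_⟩
  intro m n r km kn lam₀ sig lam R C Ω _ P _ Z hr hkm hkn hlam₀ hsig hR hC hRs hCs hlam hbm hbn _
    hZ hsnr
  have hsep := isSeparated_of_comparable hK hkm hkn hlam₀ hR hC hRs hCs hlam hbn
  have hsep' := isSeparated_of_comparable hK hkn hkm hlam₀ hC hR hCs hRs hlam hbm
  have hm : 1 ≤ m := hr.trans hsep.le_dim
  have hn : 1 ≤ n := hr.trans hsep'.le_dim
  have n1 := Real.sqrt_nonneg (r / min km kn)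
  have n2 := (Real.sqrt_nonneg (Real.log n / km)).trans
    (le_max_left _ (√(Real.log m / kn)))
  have n3 := Real.sqrt_nonneg (max (m : ℝ) n / (km * kn))
  have hcol : 2400 * K ^ 5 / √a * (√(r / min km kn) + √(Real.log n / km)) ≤ lam₀ / sig := by
    refine le_trans (mul_le_mul_of_nonneg_left ?_ hC₀.le) hsnr
    linarith [le_max_left (√(Real.log n / km)) (√(Real.log m / kn))]
  have hrow : 2400 * K ^ 5 / √a * (√(r / min kn km) + √(Real.log m / kn)) ≤ lam₀ / sig := by
    refine le_trans (mul_le_mul_of_nonneg_left ?_ hC₀.le) hsnr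
    rw [min_comm kn km]
    linarith [le_max_right (√(Real.log n / km)) (√(Real.log m / kn))]
  have hnorm : 2400 * K ^ 5 / √a * √(max (m : ℝ) n / (km * kn)) ≤ lam₀ / sig := by
    refine le_trans (mul_le_mul_of_nonneg_left ?_ hC₀.le) hsnr
    linarith
  have hnorm' : 2400 * K ^ 5 / √a * √(max (n : ℝ) m / (kn * km)) ≤ lam₀ / sig := by
    rwa [max_comm, mul_comm kn km]
  obtain ⟨E₁, hE₁, hP₁, hsmall₁⟩ := hsep.exists_event hZ ha hsig hn
    (proj_threshold_le ha hK hkm hkn hsig hcol)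
  obtain ⟨E₂, hE₂, hP₂, hsmall₂⟩ := hsep'.exists_event hZ.transpose ha hsig hm
    (proj_threshold_le ha hK hkn hkm hsig hrow)
  have hZm : Measurable Z := measurable_matrix_iff.2 hZ.measurable
  -- A single operator norm event serves both columns and rows, since transposing preserves the
  -- norm.
  set t := 12 * √(sig ^ 2 / a) * √((m : ℝ) + n) with ht
  set E₃ : Set Ω := {ω | t < ‖Z ω‖}ᶜ with hE₃def
  have hE₃ : MeasurableSet E₃ :=
    (measurableSet_lt measurable_const (measurable_norm.comp hZm)).compl
  have hP₃ : P E₃ᶜ ≤ ENNReal.ofReal (Real.exp (-((m : ℝ) + n))) := by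
    rw [hE₃def, compl_compl]
    exact measure_lt_opNorm_le P hZ.measurable (by positivity) (hZ.lintegral_exp_bilin_le ha)
  refine ⟨E₁ ∩ E₂ ∩ E₃, (hE₁.inter hE₂).inter hE₃, ?_, ?_⟩
  · have hcompl : P (E₁ ∩ E₂ ∩ E₃)ᶜ ≤ ENNReal.ofReal ((n : ℝ) ^ (-1 : ℝ) + (m : ℝ) ^ (-1 : ℝ)
        + Real.exp (-((m : ℝ) + n))) := by
      rw [ENNReal.ofReal_add (by positivity) (by positivity),
        ENNReal.ofReal_add (by positivity) (by positivity), Set.compl_inter, Set.compl_inter]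
      exact (measure_union_le _ _).trans
        (add_le_add ((measure_union_le _ _).trans (add_le_add hP₁ hP₂)) hP₃)
    have hreal : P.real (E₁ ∩ E₂ ∩ E₃)ᶜ ≤ (n : ℝ) ^ (-1 : ℝ) + (m : ℝ) ^ (-1 : ℝ)
        + Real.exp (-((m : ℝ) + n)) := ENNReal.toReal_le_of_le_ofReal (by positivity) hcompl
    rw [probReal_compl_eq_one_sub ((hE₁.inter hE₂).inter hE₃)] at hreal
    rw [neg_one_mul]
    linarith [Real.exp_pos (-((m : ℝ) + n))]
  · rintro ω ⟨⟨hω₁, hω₂⟩, hω₃⟩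
    have hω : ‖Z ω‖ ≤ t := not_lt.1 hω₃
    have hω' : ‖(Z ω)ᵀ‖ ≤ t := (opNorm_transpose _).trans_le hω
    refine spectralSucceeds_of_isSmallNoise hsep
      (hsmall₁ ω hω₁ (hω.trans (norm_threshold_le ha hK hkm hkn hlam₀ hsig hnorm))) hsep'
      (hsmall₂ ω hω₂ (hω'.trans ?_))
    rw [ht, add_comm (m : ℝ) n]
    exact norm_threshold_le ha hK hkn hkm hlam₀ hsig hnorm'
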